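/- All functions are complex-analytic, and every function of the variables $u^i_k$ depends on only finitely many of them. Consider an evolution system $\partial u^i/\partial t=F^i(x,t,u^{1}_0,\dots,u^m_0,\dots,u^1_d,\dots,u^m_d)$, $i=1,\dots,m$, where $u^i=u^i(x,t)$, $u^i_k=\partial^k u^i/\partial x^k$, and $F$ is defined on an open set. Let $\mathcal E$ be its infinite prolongation, i.e. the infinite-dimensional manifold with coordinates $x,t,u^i_k$ ($1\le i\le m$, $k\ge 0$) over the domain of $F$, with total derivatives $$D_x=\frac{\partial}{\partial x}+\sum_{i,k}u^i_{k+1}\frac{\partial}{\partial u^i_k},\qquad D_t=\frac{\partial}{\partial t}+\sum_{i,k}D_x^k(F^i)\frac{\partial}{\partial u^i_k}.$$ Let $W\subseteq\mathbb C^q$ be open with coordinates $w^1,\dots,w^q$. A covering is a pair $D_x+A$, $D_t+B$ with $A=\sum_j\alpha^j(w,x,t,u)\,\partial/\partial w^j$, $B=\sum_j\beta^j(w,x,t,u)\,\partial/\partial w^j$ on $\mathcal E\times W$ (or on an open subset of it) such that $D_x(B)-D_t(A)+[A,B]=0$; it is of order $\le p$ if $\partial A/\partial u^i_s=0$ for all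 $i$ and all $s>p$. A gauge transformation $w^j\mapsto g^j(w,x,t,u)$ is a change of variables $G(x,t,u,w)=(x,t,u,g(w,x,t,u))$ that is an analytic isomorphism onto an open set; it transforms the covering into the one with components $$\tilde\alpha=\Bigl(\frac{\partial g}{\partial w}\Bigr)^{-1}\bigl(\alpha\circ G-D_x(g)\bigr),\qquad \tilde\beta=\Bigl(\frac{\partial g}{\partial w}\Bigr)^{-1}\bigl(\beta\circ G-D_t(g)\bigr).$$ Order the index pairs by $(i,k)\prec(i',k')$ iff $k<k'$, or $k=k'$ and $i<i'$. **Theorem.** Fix a covering of order $\le p$, a point $a=(x_0,t_0,a^i_k)\in\mathcal E$ and a point $b\in W$ (with $(a,b)$ in the domain of the covering). On a neighborhood of $(a,b)$ there is a unique gauge transformation $w^j\mapsto g^j(w,x,t,u)$, $j=1,\dots,q$, such that 1. the transformed fields, written again $D_x+A$, $D_t+B$, satisfy, for all $i_0\in\{1,\dots,m\}$ and all integers $k_0\ge 1$, $$\frac{\partial A}{\partial u^{i_0}_{k_0}}\bigg|_{u^i_k=a^i_k\ \forall (i,k)\succ(i_0,k_0-1)}=0,\qquad A\Big|_{u^i_k=a^i_k\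 \forall i,k}=0,\qquad B\Big|_{x=x_0,\ u^i_k=a^i_k\ \forall i,k}=0;$$ 2. $g^j\big|_{x=x_0,\,t=t_0,\,u^i_k=a^i_k\ \forall i,k}=w^j$ for $j=1,\dots,q$. Uniqueness holds on a suitable neighborhood, and also for germs: any two such transformations, each defined on some neighborhood of $(a,b)$, agree near $(a,b)$. Moreover, $\partial g^j/\partial u^i_k=0$ for all $k\ge p$ and all $i,j$, and the transformed fields again form a covering of order $\le p$. (For $m=1$ the first condition reads $\partial A/\partial u_s|_{u_k=a_k,\ k\ge s}=0$ for all $s\ge1$.) -/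

import Mathlib

open scoped Topology

namespace EvoCov

noncomputable section

/-- Coordinates `(x, t, u^i_k)` with `i` ranging over `m` values and all `k ≥ 0`, with the
product topology. -/
abbrev Jet (m : ℕ) : Type := ℂ × ℂ × (Fin m → ℕ → ℂ)

/-- Coordinates `(x, t, u^i_k)` with `0 ≤ k ≤ n`. -/
abbrev FinJet (m n : ℕ) : Type := ℂ × ℂ × (Fin m → Fin (n + 1) → ℂ)

/-- Forget the coordinates `u^i_k` with `k > n`. -/
def trunc {m : ℕ} (n : ℕ) (y : Jet m) : FinJet m n :=
  (y.1, y.2.1, fun i k => y.2.2 i k)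

/-- Points of the jet space together with the coordinates `w^1, …, w^q`. -/
abbrev Tot (m q : ℕ) : Type := Jet m × (Fin q → ℂ)

/-- `f` is a complex-analytic function on `Ω` that depends on `w`, `x`, `t` and only finitely
many of the variables `u^i_k`. -/
def FinAnalyticOn {m q : ℕ} (f : Tot m q → (Fin q → ℂ)) (Ω : Set (Tot m q)) : Prop :=
  ∃ (n : ℕ) (φ : FinJet m n × (Fin q → ℂ) → (Fin q → ℂ)),
    ∀ z ∈ Ω, AnalyticAt ℂ φ (trunc n z.1, z.2) ∧ f z = φ (trunc n z.1, z.2)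

section Derivatives

variable {m : ℕ} {V : Type*} [NormedAddCommGroup V] [NormedSpace ℂ V]

/-- The point `y` with the value of `u^i_k` replaced by `s`. -/
def setU (y : Jet m) (i : Fin m) (k : ℕ) (s : ℂ) : Jet m :=
  (y.1, y.2.1, Function.update y.2.2 i (Function.update (y.2.2 i) k s))

/-- `∂f/∂x`. -/
def pdx (f : Jet m → V) (y : Jet m) : V :=
  deriv (fun s : ℂ => f (s, y.2.1, y.2.2)) y.1

/-- `∂f/∂t`. -/
def pdt (f : Jet m → V) (y : Jet m) : V :=
  deriv (fun s : ℂ => f (y.1, s, y.2.2)) y.2.1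

/-- `∂f/∂u^i_k`. -/
def pdu (i : Fin m) (k : ℕ) (f : Jet m → V) (y : Jet m) : V :=
  deriv (fun s : ℂ => f (setU y i k s)) (y.2.2 i k)

/-- The total derivative `D_x = ∂/∂x + ∑_{i,k} u^i_{k+1} ∂/∂u^i_k`. The sum has only finitely many
nonzero terms when `f` depends on finitely many variables. -/
def Dx (f : Jet m → V) (y : Jet m) : V :=
  pdx f y + ∑ᶠ ik : Fin m × ℕ, y.2.2 ik.1 (ik.2 + 1) • pdu ik.1 ik.2 f y

end Derivatives

/-- An evolution system `∂u^i/∂t = F^i(x, t, u, u_1, …, u_d)`, `i = 1, …, m`, with `F` analytic on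
an open set `dom`. -/
structure EvolutionSystem (m d : ℕ) where
  dom : Set (FinJet m d)
  isOpen_dom : IsOpen dom
  F : FinJet m d → Fin m → ℂ
  analytic_F : AnalyticOnNhd ℂ F dom

namespace EvolutionSystem

variable {m d : ℕ} (S : EvolutionSystem m d)

/-- The infinite prolongation `ℰ`: the manifold with coordinates `x`, `t`, `u^i_k`, `k ≥ 0`. -/
def prolongation : Set (Jet m) := {y | trunc d y ∈ S.dom}

/-- `F^i` as a function on the infinite prolongation. -/
def rhs (i : Fin m) (y : Jet m) : ℂ := S.F (trunc d y) i

/-- The total derivative `D_t = ∂/∂t + ∑_{i,k} D_x^k(F^i) ∂/∂u^i_k`. -/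
def Dt {V : Type*} [NormedAddCommGroup V] [NormedSpace ℂ V] (f : Jet m → V) (y : Jet m) : V :=
  pdt f y + ∑ᶠ ik : Fin m × ℕ, (Dx^[ik.2] (S.rhs ik.1)) y • pdu ik.1 ik.2 f y

/-- The vector fields `D_x + A`, `D_t + B` with `A = ∑_j α^j ∂/∂w^j`, `B = ∑_j β^j ∂/∂w^j` form a
covering over the open set `Ω ⊆ ℰ × ℂ^q`: one has `D_x(B) - D_t(A) + [A, B] = 0` on `Ω`.
A vector field in the `w`-directions is given by the vector of its components. -/
structure IsCovering {q : ℕ} (Ω : Set (Tot m q)) (A B : Tot m q → (Fin q → ℂ)) : Prop where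
  isOpen : IsOpen Ω
  subset : ∀ z ∈ Ω, z.1 ∈ S.prolongation
  analytic_A : FinAnalyticOn A Ω
  analytic_B : FinAnalyticOn B Ω
  compat : ∀ z ∈ Ω,
    Dx (fun y => B (y, z.2)) z.1 - S.Dt (fun y => A (y, z.2)) z.1
      + VectorField.lieBracket ℂ (fun w => A (z.1, w)) (fun w => B (z.1, w)) z.2 = 0

end EvolutionSystem

variable {m q : ℕ}

/-- The covering with `x`-part `A` has order `≤ p` on `Ω`: `∂A/∂u^i_s = 0` for all `s > p`. -/
def OrderLE (p : ℕ) (Ω : Set (Tot m q)) (A : Tot m q → (Fin q → ℂ)) : Prop :=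
  ∀ z ∈ Ω, ∀ (i : Fin m) (s : ℕ), p < s → pdu i s (fun y => A (y, z.2)) z.1 = 0

/-- The map `G (y, w) = (y, g(w, y))` of total spaces given by the functions `g^j`. -/
def gaugeMap (g : Tot m q → (Fin q → ℂ)) (z : Tot m q) : Tot m q := (z.1, g z)

/-- `w ↦ g(w, x, t, u)` is a gauge transformation on the open set `N`: an analytic change of
variables, with an analytic inverse defined on the open image of `N`. -/
structure IsGauge (N : Set (Tot m q)) (g : Tot m q → (Fin q → ℂ)) : Prop where
  isOpen : IsOpen N
  analytic : FinAnalyticOn g N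
  isOpen_image : IsOpen (gaugeMap g '' N)
  invertible : ∃ h : Tot m q → (Fin q → ℂ),
    FinAnalyticOn h (gaugeMap g '' N) ∧ ∀ z ∈ N, h (gaugeMap g z) = z.2

/-- The Jacobian `∂g/∂w`. -/
def jac (g : Tot m q → (Fin q → ℂ)) (z : Tot m q) : (Fin q → ℂ) →L[ℂ] (Fin q → ℂ) :=
  fderiv ℂ (fun w => g (z.1, w)) z.2

/-- The `x`-part of the transformed covering, `(∂g/∂w)⁻¹ (A(g, x, t, u) - D_x(g))`. -/
def gaugeA (g A : Tot m q → (Fin q → ℂ)) (z : Tot m q) : Fin q → ℂ :=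
  (jac g z).inverse (A (gaugeMap g z) - Dx (fun y => g (y, z.2)) z.1)

/-- The `t`-part of the transformed covering, `(∂g/∂w)⁻¹ (B(g, x, t, u) - D_t(g))`. -/
def gaugeB {d : ℕ} (S : EvolutionSystem m d) (g B : Tot m q → (Fin q → ℂ)) (z : Tot m q) :
    Fin q → ℂ :=
  (jac g z).inverse (B (gaugeMap g z) - S.Dt (fun y => g (y, z.2)) z.1)

/-- The ordering `(1,0) ≺ (2,0) ≺ … ≺ (m,0) ≺ (1,1) ≺ …` of the indices of the `u^i_k`. -/
def Prec (i : Fin m) (k : ℕ) (i' : Fin m) (k' : ℕ) : Prop :=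
  k < k' ∨ (k = k' ∧ i < i')

/-- The normalization conditions on `A`, `B` with respect to the point `a`, on the set `N`.
Substituting `u^i_k = a^i_k` for some of the variables means restricting to the points of `N`
at which these variables have these values. In `deriv_A` the index `k₀ + 1` runs over the positive
integers. -/
structure IsNormalized (a : Jet m) (N : Set (Tot m q)) (A B : Tot m q → (Fin q → ℂ)) : Prop where
  deriv_A : ∀ (i₀ : Fin m) (k₀ : ℕ), ∀ z ∈ N,
    (∀ (i : Fin m) (k : ℕ), Prec i₀ k₀ i k → z.1.2.2 i k = a.2.2 i k) →
      pdu i₀ (k₀ + 1) (fun y => A (y, z.2)) z.1 = 0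
  val_A : ∀ z ∈ N, z.1.2.2 = a.2.2 → A z = 0
  val_B : ∀ z ∈ N, z.1.1 = a.1 → z.1.2.2 = a.2.2 → B z = 0

/-- On the open neighborhood `N` of `(a, b)`, `g` is a gauge transformation into the domain `Ω` of
the covering given by `A`, `B`; it is the identity over `a`, and the transformed covering satisfies
the normalization conditions. -/
structure IsNormalizingGauge {d : ℕ} (S : EvolutionSystem m d) (Ω : Set (Tot m q))
    (A B : Tot m q → (Fin q → ℂ)) (a : Jet m) (b : Fin q → ℂ) (N : Set (Tot m q))
    (g : Tot m q → (Fin q → ℂ)) : Prop where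
  mem : (a, b) ∈ N
  gauge : IsGauge N g
  mapsTo : Set.MapsTo (gaugeMap g) N Ω
  normalized : IsNormalized a N (gaugeA g A) (gaugeB S g B)
  identity_at : ∀ z ∈ N, z.1 = a → g z = z.2

end

end EvoCov

/-! Write Ã for the transform of A under g, and G for the gauge map. By definition (D_x + Ã)g = A∘G.
Since [∂/∂u^i_{k+1}, D_x] = ∂/∂u^i_k, applying ∂/∂u^i_{k+1} to this relation gives, for g
independent of u^i_{k+1}, the key identity ∂g/∂u^i_k + (∂g/∂w) ∂Ã/∂u^i_{k+1} = (∂A/∂u^i_{k+1})∘G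
(`RegularAt.lineDeriv_gaugeField_unitU`). Hence, for such g, the normalization of Ã at (i,k) is an
ordinary differential equation for g in the variable u^i_k, on the locus where all later coordinates
have their values at a.

Existence: this equation is solved with initial value w at u^i_k = a^i_k, the later coordinates
frozen at a. The solution does not involve later coordinates, so conditions already achieved at
later indices survive (`exists_gauge_u`). Descending through the ordering from the index where the
order bound p makes the condition automatic settles all the derivatives of A
(`exists_gauge_vanishFrom`) and uses only u^i_k with k < p. Two more equations, in x along u = a and
in t along x = x₀, u = a, normalize A and B (`exists_gauge_x`, `exists_gauge_t`); their solutions do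
not depend on u and leave the earlier conditions intact. The required g is the composite.

Uniqueness: two normalizing gauges differ by a gauge h between normalized coverings that is the
identity over a. By the key identity ∂h/∂u^i_k vanishes on the locus where later coordinates equal
those of a. If h is already independent of those, so is ∂h/∂u^i_k, which therefore vanishes. The
same reasoning removes x and then t, so h is the identity (`IsGaugeGerm.eventually_eq_snd`).

The jet space is an infinite product without a norm. Germs therefore factor through a finite
truncation `proj n`, and D_x, D_t, ∂/∂u^i_k are all treated as line derivatives, for which
`FinAnalyticAt.lineDeriv_commutator` is the main tool. Analytic solvability of the differential
equations is `AnalyticAt.exists_flow`, obtained from the implicit function theorem on a space of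
continuous paths. -/

open Filter

/-! ### Analytic inverse and implicit functions in Banach spaces -/

section InverseFunction

variable {E F : Type*} [NormedAddCommGroup E] [NormedSpace ℂ E] [CompleteSpace E]
  [NormedAddCommGroup F] [NormedSpace ℂ F]

/-- The inverse function theorem for analytic maps of Banach spaces. -/
theorem AnalyticAt.exists_local_inverse {f : E → F} {a : E} (hf : AnalyticAt ℂ f a)
    (e : E ≃L[ℂ] F) (he : fderiv ℂ f a = e) :
    ∃ g : F → E, AnalyticAt ℂ g (f a) ∧ g (f a) = a ∧ (∀ᶠ x in 𝓝 a, g (f x) = x) ∧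
      ∀ᶠ y in 𝓝 (f a), f (g y) = y := by
  have hs : HasStrictFDerivAt f (e : E →L[ℂ] F) a := he ▸ hf.hasStrictFDerivAt
  refine ⟨hs.localInverse f e a, ?_, hs.localInverse_apply_image, hs.eventually_left_inverse,
    hs.eventually_right_inverse⟩
  exact (hs.toOpenPartialHomeomorph f).analyticAt_symm' hs.mem_toOpenPartialHomeomorph_source hf he

/-- The implicit function theorem for analytic maps, when the partial derivative is the
identity. -/
theorem AnalyticAt.exists_implicit [CompleteSpace F] {Ψ : E × F → F} {a : E} {c : F}
    (hΨ : AnalyticAt ℂ Ψ (a, c)) (h0 : Ψ (a, c) = 0)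
    (hd : (fderiv ℂ Ψ (a, c)).comp (ContinuousLinearMap.inr ℂ E F) = .id ℂ F) :
    ∃ G : E → F, AnalyticAt ℂ G a ∧ G a = c ∧ (∀ᶠ x in 𝓝 a, Ψ (x, G x) = 0) ∧
      ∀ᶠ z in 𝓝 (a, c), Ψ z = 0 → z.2 = G z.1 := by
  set L : E →L[ℂ] F := (fderiv ℂ Ψ (a, c)).comp (ContinuousLinearMap.inl ℂ E F) with hL
  have hval : ∀ v : E × F, fderiv ℂ Ψ (a, c) v = L v.1 + v.2 := by
    intro v
    have h2 := congrArg (fun T : F →L[ℂ] F => T v.2) hd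
    simp only [ContinuousLinearMap.comp_apply, ContinuousLinearMap.inr_apply,
      ContinuousLinearMap.id_apply] at h2
    rw [hL, ContinuousLinearMap.comp_apply, ContinuousLinearMap.inl_apply]
    conv_rhs => rw [← h2]
    rw [← map_add]; simp
  -- The implicit function is read off from the local inverse of Θ, restricted to the slice where
  -- the second component is 0.
  set Θ : E × F → E × F := fun z => (z.1, Ψ z) with hΘ
  have hΘa : AnalyticAt ℂ Θ (a, c) := analyticAt_fst.prod hΨ
  let e : (E × F) ≃L[ℂ] (E × F) := ContinuousLinearEquiv.equivOfInverse
    ((ContinuousLinearMap.fst ℂ E F).prod (L.comp (.fst ℂ E F) + .snd ℂ E F))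
    ((ContinuousLinearMap.fst ℂ E F).prod (.snd ℂ E F - L.comp (.fst ℂ E F)))
    (fun v => by simp) (fun v => by simp)
  have he : fderiv ℂ Θ (a, c) = e := by
    have h1 : HasFDerivAt Θ ((ContinuousLinearMap.fst ℂ E F).prod (fderiv ℂ Ψ (a, c))) (a, c) :=
      hasFDerivAt_fst.prodMk hΨ.differentiableAt.hasFDerivAt
    rw [h1.fderiv]
    ext v <;> simp [e, hval]
  obtain ⟨g, hg, hga, hl, hr⟩ := hΘa.exists_local_inverse e he
  have hΘac : Θ (a, c) = (a, 0) := by simp [hΘ, h0]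
  rw [hΘac] at hg hga hr
  have hemb : AnalyticAt ℂ (fun x : E => (x, (0 : F))) a := analyticAt_id.prod analyticAt_const
  have hg' : AnalyticAt ℂ (fun x : E => g (x, 0)) a := 
    AnalyticAt.fun_comp (f := fun x : E => (x, (0 : F))) hg hemb
  refine ⟨fun x => (g (x, 0)).2, analyticAt_snd.fun_comp hg', by simp [hga], ?_, ?_⟩
  · filter_upwards [hemb.continuousAt.eventually hr] with x hx
    have h1 : (g (x, 0)).1 = x := congrArg Prod.fst hx
    have h2 : Ψ (g (x, 0)) = 0 := congrArg Prod.snd hx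
    have h3 : (x, (g (x, 0)).2) = g (x, 0) := Prod.ext h1.symm rfl
    simpa only [h3] using h2
  · filter_upwards [hl] with z hz h
    have : Θ z = (z.1, 0) := by simp [hΘ, h]
    rw [this] at hz
    simp [hz]

end InverseFunction

/-! ### Superposition operators on spaces of continuous functions -/

section Superposition

variable {X Z E : Type*} [TopologicalSpace X] [CompactSpace X]
  [NormedAddCommGroup Z] [NormedSpace ℂ Z] [NormedAddCommGroup E] [NormedSpace ℂ E]

/-- The pointwise action of a continuous multilinear map on continuous functions. -/
noncomputable def ContinuousMultilinearMap.pointwise {n : ℕ}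
    (p : ContinuousMultilinearMap ℂ (fun _ : Fin n => Z) E) :
    ContinuousMultilinearMap ℂ (fun _ : Fin n => C(X, Z)) C(X, E) :=
  MultilinearMap.mkContinuous
    { toFun := fun γ => ⟨fun x => p fun i => γ i x, by fun_prop⟩
      map_update_add' := by
        intro _ γ i a b
        ext x
        have h : ∀ c : C(X, Z), (fun j => (Function.update γ i c) j x) =
            Function.update (fun j => γ j x) i (c x) := by
          intro c; funext j
          by_cases hj : j = i
          · subst hj; simp
          · simp [hj]
        simp only [ContinuousMap.coe_mk, ContinuousMap.add_apply, h]
        convert p.map_update_add (fun j => γ j x) i (a x) (b x) using 2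
      map_update_smul' := by
        intro _ γ i r a
        ext x
        have h : ∀ c : C(X, Z), (fun j => (Function.update γ i c) j x) =
            Function.update (fun j => γ j x) i (c x) := by
          intro c; funext j
          by_cases hj : j = i
          · subst hj; simp
          · simp [hj]
        simp only [ContinuousMap.coe_mk, ContinuousMap.smul_apply, h]
        convert p.map_update_smul (fun j => γ j x) i r (a x) using 2 }
    ‖p‖ (by
      intro γ
      refine (ContinuousMap.norm_le _ (by positivity)).2 fun x => ?_
      refine (p.le_opNorm _).trans ?_
      gcongr with i
      exact (γ i).norm_coe_le_norm x)

/-- Composition with an analytic function is an analytic operation on continuous functions. -/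
theorem AnalyticAt.exists_superposition [CompleteSpace E] {f : Z → E} {z₀ : Z}
    (hf : AnalyticAt ℂ f z₀) :
    ∃ S : C(X, Z) → C(X, E), AnalyticAt ℂ S (ContinuousMap.const X z₀) ∧
      ∀ᶠ γ in 𝓝 (ContinuousMap.const X z₀), ∀ x, S γ x = f (γ x) := by
  obtain ⟨p, r, hp⟩ := hf
  let P : FormalMultilinearSeries ℂ C(X, Z) C(X, E) := fun n => (p n).pointwise
  -- The pointwise action does not increase the norm of any term, so the lifted power series
  -- converges at least as far as the original one.
  have hle : p.radius ≤ P.radius := by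
    refine FormalMultilinearSeries.radius_le_of_le fun n => ?_
    exact MultilinearMap.mkContinuous_norm_le _ (norm_nonneg _) _
  have hr : r ≤ P.radius := hp.r_le.trans hle
  have hP := (P.hasFPowerSeriesOnBall (hp.r_pos.trans_le hr)).mono hp.r_pos hr
  refine ⟨fun γ => P.sum (γ - ContinuousMap.const X z₀), ?_, ?_⟩
  · have := hP.comp_sub (ContinuousMap.const X z₀)
    rw [zero_add] at this
    exact this.analyticAt
  · filter_upwards [Metric.eball_mem_nhds (ContinuousMap.const X z₀) hp.r_pos] with γ hγ x
    have hγ' : γ - ContinuousMap.const X z₀ ∈ Metric.eball (0 : C(X, Z)) r := by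
      simpa [edist_eq_enorm_sub] using hγ
    have h1 := hP.hasSum hγ'
    rw [zero_add] at h1
    have h2 := h1.mapL (ContinuousMap.evalCLM ℂ x)
    have hx : γ x - z₀ ∈ Metric.eball (0 : Z) r := by
      simp only [Metric.mem_eball, edist_zero_right] at hγ' ⊢
      refine lt_of_le_of_lt ?_ hγ'
      have := (γ - ContinuousMap.const X z₀).norm_coe_le_norm x
      simp only [ContinuousMap.sub_apply, ContinuousMap.const_apply] at this
      simpa [enorm_le_iff_norm_le] using this
    have h3 := hp.hasSum hx
    rw [add_sub_cancel] at h3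
    refine h2.unique ?_
    convert h3 using 1
    funext n
    rfl

end Superposition

/-! ### Analytic ordinary differential equations in the complex domain -/

section Flow

variable {E P : Type*} [NormedAddCommGroup E] [NormedSpace ℂ E] 
  [NormedAddCommGroup P] [NormedSpace ℂ P]

/-- The operator `(J γ)(σ) = σ ∫₀¹ γ(ρσ) dρ = ∫₀^σ γ` on continuous paths. -/
noncomputable def pathPrimitive : C(unitInterval, E) →L[ℂ] C(unitInterval, E) :=
  LinearMap.mkContinuous
    { toFun := fun γ => ⟨fun σ =>
          (σ : ℝ) • ∫ ρ in (0 : ℝ)..1, γ (Set.projIcc 0 1 zero_le_one ρ * σ), by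
        refine continuous_subtype_val.smul
          (intervalIntegral.continuous_parametric_intervalIntegral_of_continuous' ?_ 0 1)
        exact γ.continuous.comp
          ((continuous_projIcc.comp continuous_snd).mul continuous_fst)⟩
      map_add' := by
        intro γ δ
        ext σ
        simp only [ContinuousMap.add_apply, ContinuousMap.coe_mk]
        rw [intervalIntegral.integral_add, smul_add]
        · exact (γ.continuous.comp (continuous_projIcc.mul continuous_const)).intervalIntegrable _ _
        · exact (δ.continuous.comp (continuous_projIcc.mul continuous_const)).intervalIntegrable _ _
      map_smul' := by
        intro c γ
        ext σ
        simp only [ContinuousMap.smul_apply, ContinuousMap.coe_mk, RingHom.id_apply]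
        rw [intervalIntegral.integral_smul, smul_comm] }
    1 (by
      intro γ
      refine (ContinuousMap.norm_le _ (by positivity)).2 fun σ => ?_
      simp only [LinearMap.coe_mk, AddHom.coe_mk, ContinuousMap.coe_mk, norm_smul,
        Real.norm_eq_abs, abs_of_nonneg σ.2.1]
      have h1 : ‖∫ ρ in (0 : ℝ)..1, γ (Set.projIcc 0 1 zero_le_one ρ * σ)‖ ≤ ‖γ‖ * |1 - 0| :=
        intervalIntegral.norm_integral_le_of_norm_le_const fun ρ _ => γ.norm_coe_le_norm _
      have h2 := mul_le_mul σ.2.2 h1 (norm_nonneg _) zero_le_one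
      simpa using h2)

theorem pathPrimitive_apply (γ : C(unitInterval, E)) (σ : unitInterval) :
    pathPrimitive γ σ =
    (σ : ℝ) • ∫ ρ in (0 : ℝ)..1, γ (Set.projIcc 0 1 zero_le_one ρ * σ) := rfl

/-- The continuous linear map `((w, θ, p), γ) ↦ (σ ↦ (γ σ, σ θ, p))`. -/
noncomputable def pathLift : ((E × ℂ × P) × C(unitInterval, E)) →L[ℂ] C(unitInterval, E × ℂ × P) :=
  LinearMap.mkContinuous
    { toFun := fun v => ⟨fun σ => (v.2 σ, ((σ : ℝ) : ℂ) * v.1.2.1, v.1.2.2), by fun_prop⟩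
      map_add' := by intro u v; ext σ <;> simp [mul_add]
      map_smul' := by intro c v; ext σ <;> simp [mul_left_comm] }
    1 (by
      intro v
      refine (ContinuousMap.norm_le _ (by positivity)).2 fun σ => ?_
      simp only [LinearMap.coe_mk, AddHom.coe_mk, ContinuousMap.coe_mk, Prod.norm_def, one_mul]
      refine max_le ((v.2.norm_coe_le_norm σ).trans (le_max_right _ _)) ?_
      refine le_trans ?_ (le_max_left _ _)
      refine le_trans (max_le_max ?_ le_rfl) (le_max_right _ _)
      rw [norm_mul, Complex.norm_real, Real.norm_eq_abs, abs_of_nonneg σ.2.1]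
      exact mul_le_of_le_one_left (norm_nonneg _) σ.2.2)

theorem pathLift_apply (v : (E × ℂ × P) × C(unitInterval, E)) (σ : unitInterval) :
    pathLift v σ = (v.2 σ, ((σ : ℝ) : ℂ) * v.1.2.1, v.1.2.2) := rfl

/-- Scaling the parameter of a path. -/
def pathScale {E : Type*} [TopologicalSpace E] (σ : unitInterval) (γ : C(unitInterval, E)) :
    C(unitInterval, E) :=
  γ.comp ⟨fun τ => τ * σ, by fun_prop⟩

theorem pathScale_apply {E : Type*} [TopologicalSpace E] (σ τ : unitInterval)
    (γ : C(unitInterval, E)) : pathScale σ γ τ = γ (τ * σ) := rfl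

/-- An analytic solution, for small complex time, of the integral equation
`g(w, θ, p) = w + θ ∫₀¹ F(g(w, ρθ, p), ρθ, p) dρ`. -/
theorem AnalyticAt.exists_integral_flow [CompleteSpace E] [CompleteSpace P]
    {F : E × ℂ × P → E} {e₀ : E} {p₀ : P}
    (hF : AnalyticAt ℂ F (e₀, 0, p₀)) :
    ∃ g : E × ℂ × P → E, AnalyticAt ℂ g (e₀, 0, p₀) ∧ g (e₀, 0, p₀) = e₀ ∧
      ∀ᶠ q in 𝓝 (e₀, (0 : ℂ), p₀),
        g q = q.1 + q.2.1 • ∫ ρ in (0 : ℝ)..1, F (g (q.1, ρ * q.2.1, q.2.2), ρ * q.2.1, q.2.2) := by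
  obtain ⟨S, hS, hSF⟩ := hF.exists_superposition (X := unitInterval)
  set γ₀ : C(unitInterval, E) := ContinuousMap.const unitInterval e₀ with hγ₀
  set q₀ : E × ℂ × P := (e₀, 0, p₀) with hq₀
  have hlift₀ : pathLift (q₀, γ₀) = ContinuousMap.const unitInterval q₀ := by
    ext σ <;> simp [pathLift_apply, hq₀, hγ₀]
  let cst : E →L[ℂ] C(unitInterval, E) := LinearMap.mkContinuous
    { toFun := fun w => ContinuousMap.const unitInterval w
      map_add' := fun _ _ => rfl
      map_smul' := fun _ _ => rfl } 1 (fun w => by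
        refine (ContinuousMap.norm_le _ (by positivity)).2 fun σ => ?_
        exact (one_mul ‖w‖).ge)
  have hcst : ∀ w σ, cst w σ = w := fun _ _ => rfl
  set Ψ : (E × ℂ × P) × C(unitInterval, E) → C(unitInterval, E) := fun v =>
    v.2 - cst v.1.1 - v.1.2.1 • pathPrimitive (S (pathLift v)) with hΨ
  have hSl : AnalyticAt ℂ (fun v => S (pathLift v)) (q₀, γ₀) :=
    AnalyticAt.fun_comp (g := S) (f := pathLift) (by rw [hlift₀]; exact hS)
      ((pathLift (E := E) (P := P)).analyticAt (q₀, γ₀))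
  have hθ : AnalyticAt ℂ (fun v : (E × ℂ × P) × C(unitInterval, E) => v.1.2.1) (q₀, γ₀) :=
    analyticAt_fst.fun_comp (analyticAt_snd.fun_comp analyticAt_fst)
  have hw : AnalyticAt ℂ (fun v : (E × ℂ × P) × C(unitInterval, E) => v.1.1) (q₀, γ₀) :=
    analyticAt_fst.fun_comp analyticAt_fst
  have hΨa : AnalyticAt ℂ Ψ (q₀, γ₀) := by
    refine (analyticAt_snd.sub ((cst.analyticAt _).fun_comp hw)).sub (hθ.smul ?_)
    exact (pathPrimitive.analyticAt _).fun_comp hSl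
  have hΨ0 : Ψ (q₀, γ₀) = 0 := by
    ext σ; simp [hΨ, hq₀, hγ₀, hcst]
  have hd : (fderiv ℂ Ψ (q₀, γ₀)).comp
      (ContinuousLinearMap.inr ℂ (E × ℂ × P) C(unitInterval, E)) = .id ℂ _ := by
    have h1 : HasFDerivAt (fun γ => Ψ (q₀, γ))
        ((fderiv ℂ Ψ (q₀, γ₀)).comp (ContinuousLinearMap.inr ℂ (E × ℂ × P) C(unitInterval, E))) γ₀ :=
      hΨa.differentiableAt.hasFDerivAt.comp γ₀ (hasFDerivAt_prodMk_right q₀ γ₀)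
    -- At θ = 0 the integral term drops out and Ψ is γ minus a constant path.
    have h2 : HasFDerivAt (fun γ => Ψ (q₀, γ)) (.id ℂ _) γ₀ := by
      have : (fun γ => Ψ (q₀, γ)) = fun γ => γ - cst e₀ := by
        funext γ; simp [hΨ, hq₀]
      rw [this]
      exact (hasFDerivAt_id γ₀).sub_const _
    exact h1.unique h2
  obtain ⟨G, hG, hG0, hGΨ, huniq⟩ := hΨa.exists_implicit hΨ0 hd
  refine ⟨fun q => G q 1, ((ContinuousMap.evalCLM ℂ (1 : unitInterval)).analyticAt _).fun_comp hG,
    by simp only [hG0]; rfl, ?_⟩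
  have hGc : Tendsto (fun q => (q, G q)) (𝓝 q₀) (𝓝 (q₀, γ₀)) := by
    have := (continuousAt_id.prodMk hG.continuousAt : ContinuousAt (fun q => (q, G q)) q₀)
    simpa [ContinuousAt, hG0] using this
  have hlift : Tendsto (fun v => pathLift v) (𝓝 (q₀, γ₀))
      (𝓝 (ContinuousMap.const unitInterval q₀)) := by
    have := (pathLift (E := E) (P := P)).continuous.tendsto (q₀, γ₀)
    rwa [hlift₀] at this
  -- a ball on which uniqueness holds, stable under scaling
  obtain ⟨ε, hε, hball⟩ := Metric.eventually_nhds_iff_ball.1 (huniq.and (hlift.eventually hSF))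
  filter_upwards [hGΨ, hGc.eventually (Metric.ball_mem_nhds _ hε)] with q hq hqε
  set γ := G q with hγ
  have hqd : dist q q₀ < ε ∧ dist γ γ₀ < ε := by
    rw [← max_lt_iff]; exact hqε
  have hscale : ∀ σ : unitInterval, ((q.1, ((σ : ℝ) : ℂ) * q.2.1, q.2.2), pathScale σ γ) ∈
      Metric.ball (q₀, γ₀) ε := by
    intro σ
    rw [Metric.mem_ball, Prod.dist_eq, max_lt_iff]
    constructor
    · refine lt_of_le_of_lt ?_ hqd.1
      simp only [hq₀, Prod.dist_eq, dist_zero_right]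
      refine max_le_max le_rfl (max_le_max ?_ le_rfl)
      rw [norm_mul, Complex.norm_real, Real.norm_eq_abs, abs_of_nonneg σ.2.1]
      exact mul_le_of_le_one_left (norm_nonneg _) σ.2.2
    · refine lt_of_le_of_lt ?_ hqd.2
      rw [ContinuousMap.dist_le dist_nonneg]
      intro τ
      exact ContinuousMap.dist_apply_le_dist (f := γ) (g := γ₀) (τ * σ)
  have hSγ : ∀ τ, S (pathLift (q, γ)) τ = F (γ τ, ((τ : ℝ) : ℂ) * q.2.1, q.2.2) := fun τ =>
    (hball _ hqε).2 τ
  have heq : ∀ τ : unitInterval, γ τ = q.1 + q.2.1 • pathPrimitive (S (pathLift (q, γ))) τ := by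
    intro τ
    have := congrArg (fun δ : C(unitInterval, E) => δ τ) hq
    simp only [hΨ, ContinuousMap.sub_apply, ContinuousMap.smul_apply, hcst,
      ContinuousMap.zero_apply] at this
    rw [sub_sub, sub_eq_zero] at this
    exact this
  -- The path γ rescaled by σ solves the integral equation for time σθ and stays in the ball of
  -- uniqueness, so it is the path that G assigns to σθ. Thus intermediate points of γ are values of
  -- the flow itself.
  have hkey : ∀ σ : unitInterval, γ σ = G (q.1, ((σ : ℝ) : ℂ) * q.2.1, q.2.2) 1 := by
    intro σ
    have h := hball _ (hscale σ)
    have hz : Ψ ((q.1, ((σ : ℝ) : ℂ) * q.2.1, q.2.2), pathScale σ γ) = 0 := by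
      ext τ
      simp only [hΨ, ContinuousMap.sub_apply, ContinuousMap.smul_apply, hcst,
        ContinuousMap.zero_apply, pathScale_apply]
      rw [heq (τ * σ), pathPrimitive_apply, pathPrimitive_apply]
      simp only [h.2, hSγ, pathLift_apply, pathScale_apply]
      rw [sub_sub, sub_eq_zero]
      congr 1
      simp only [Set.Icc.coe_mul, Complex.ofReal_mul, mul_assoc, mul_smul]
      rw [Complex.coe_smul, smul_comm (σ : ℝ) q.2.1, smul_comm (σ : ℝ) (τ : ℝ)]
    have := h.1 hz
    rw [← this]
    simp [pathScale_apply]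
  have h1 := heq 1
  rw [pathPrimitive_apply] at h1
  simp only [hSγ, mul_one, Set.Icc.coe_one, one_smul] at h1
  rw [h1]
  congr 2
  refine intervalIntegral.integral_congr fun ρ hρ => ?_
  rw [Set.uIcc_of_le zero_le_one] at hρ
  have : ((Set.projIcc (0 : ℝ) 1 zero_le_one ρ : unitInterval) : ℝ) = ρ := by
    rw [Set.projIcc_of_mem _ hρ]
  simp only [hkey, this]

/-- Local solvability of analytic ordinary differential equations in the complex domain, with
analytic dependence on initial values and parameters. -/
theorem AnalyticAt.exists_flow [CompleteSpace E] [CompleteSpace P] {F : E × ℂ × P → E} {e₀ : E}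
    {p₀ : P} (hF : AnalyticAt ℂ F (e₀, 0, p₀)) :
    ∃ g : E × ℂ × P → E, AnalyticAt ℂ g (e₀, 0, p₀) ∧ g (e₀, 0, p₀) = e₀ ∧
      (∀ᶠ q in 𝓝 (e₀, (0 : ℂ), p₀), q.2.1 = 0 → g q = q.1) ∧
      ∀ᶠ q in 𝓝 (e₀, (0 : ℂ), p₀),
        HasDerivAt (fun s => g (q.1, s, q.2.2)) (F (g q, q.2)) q.2.1 := by
  obtain ⟨g, hg, hg0, hgint⟩ := hF.exists_integral_flow
  refine ⟨g, hg, hg0, hgint.mono fun q hq h0 => by rw [hq, h0]; simp, ?_⟩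
  have hFg : ∀ᶠ q in 𝓝 (e₀, (0 : ℂ), p₀), AnalyticAt ℂ F (g q, q.2) := by
    have : ContinuousAt (fun q => (g q, q.2)) (e₀, (0 : ℂ), p₀) :=
      hg.continuousAt.prodMk continuousAt_snd
    have h2 := this.tendsto
    rw [hg0] at h2
    exact h2.eventually hF.eventually_analyticAt
  obtain ⟨ε, hε, hball⟩ := Metric.eventually_nhds_iff_ball.1
    ((hgint.and hFg).and hg.eventually_analyticAt)
  have hcurve : ∀ (w : E) (p : P) (s : ℂ), (w, s, p) ∈ Metric.ball (e₀, (0 : ℂ), p₀) ε →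
      AnalyticAt ℂ (fun s => g (w, s, p)) s := fun w p s h =>
    AnalyticAt.fun_comp (f := fun s => (w, s, p)) (hball _ h).2
      (analyticAt_const.prod (analyticAt_id.prod analyticAt_const))
  have hFcurve : ∀ (w : E) (p : P) (s : ℂ), (w, s, p) ∈ Metric.ball (e₀, (0 : ℂ), p₀) ε →
      ContinuousAt (fun s => F (g (w, s, p), s, p)) s := fun w p s h =>
    ContinuousAt.comp (f := fun s => (g (w, s, p), s, p)) (hball _ h).1.2.continuousAt
      ((hcurve w p s h).continuousAt.prodMk (continuousAt_id.prodMk continuousAt_const))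
  -- On the real ray r ↦ rθ the integral equation reads g = w + θ ∫₀^r H. Its derivative at r = 1 is
  -- θ H(1), while the chain rule gives θ times the complex derivative; θ ≠ 0 cancels. Halving the
  -- ball makes r = 1 interior to the admissible range |r| < 2.
  have hne : ∀ (w : E) (θ : ℂ) (p : P), θ ≠ 0 →
      (w, θ, p) ∈ Metric.ball (e₀, (0 : ℂ), p₀) (ε / 2) →
      deriv (fun s => g (w, s, p)) θ = F (g (w, θ, p), θ, p) := by
    intro w θ p hθ hq
    have hmem : ∀ r : ℝ, |r| < 2 → (w, (r : ℂ) * θ, p) ∈ Metric.ball (e₀, (0 : ℂ), p₀) ε := by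
      intro r hr
      simp only [Metric.mem_ball, Prod.dist_eq, dist_zero_right, max_lt_iff] at hq ⊢
      refine ⟨by linarith, ?_, by linarith⟩
      rw [norm_mul, Complex.norm_real, Real.norm_eq_abs]
      nlinarith [abs_nonneg r, norm_nonneg θ]
    set H : ℝ → E := fun r => F (g (w, r * θ, p), r * θ, p) with hH
    have hHc : ∀ r : ℝ, |r| < 2 → ContinuousAt H r := by
      intro r hr
      exact ContinuousAt.comp (f := fun r : ℝ => (r : ℂ) * θ)
        (g := fun s : ℂ => F (g (w, s, p), s, p)) (hFcurve w p _ (hmem r hr)) (by fun_prop)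
    have hHint : ∀ r : ℝ, |r| < 2 → g (w, r * θ, p) = w + θ • ∫ ρ in (0 : ℝ)..r, H ρ := by
      intro r hr
      have h1 := (hball _ (hmem r hr)).1.1
      simp only at h1
      rw [h1]
      have h2 : (∫ ρ in (0 : ℝ)..1, F (g (w, ρ * (r * θ), p), ρ * (r * θ), p)) =
          ∫ ρ in (0 : ℝ)..1, H (ρ * r) := by
        refine intervalIntegral.integral_congr fun ρ _ => ?_
        simp only [hH, Complex.ofReal_mul, mul_assoc]
      have h3 := intervalIntegral.smul_integral_comp_mul_right (a := 0) (b := 1) H r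
      rw [zero_mul, one_mul] at h3
      rw [h2, ← h3, mul_comm, mul_smul, Complex.coe_smul]
    have hd1 : HasDerivAt (fun r : ℝ => g (w, (r : ℂ) * θ, p)) (θ • H 1) 1 := by
      have hI : HasDerivAt (fun r : ℝ => ∫ ρ in (0 : ℝ)..r, H ρ) (H 1) 1 := by
        have hco : ContinuousOn H (Set.Ioo (-2) 2) := fun r hr =>
          (hHc r (abs_lt.2 hr)).continuousWithinAt
        refine intervalIntegral.integral_hasDerivAt_right ?_ ?_ (hHc 1 (by norm_num))
        · refine (hco.mono ?_).intervalIntegrable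
          rw [Set.uIcc_of_le zero_le_one]
          exact fun r hr => ⟨by linarith [hr.1], by linarith [hr.2]⟩
        · exact hco.stronglyMeasurableAtFilter isOpen_Ioo _ ⟨by norm_num, by norm_num⟩
      refine ((hI.const_smul θ).const_add w).congr_of_eventuallyEq ?_
      have : ∀ᶠ r : ℝ in 𝓝 1, |r| < 2 :=
        continuous_abs.continuousAt.eventually_lt continuousAt_const (by norm_num)
      filter_upwards [this] with r hr using hHint r hr
    have hd2 : HasDerivAt (fun r : ℝ => g (w, (r : ℂ) * θ, p))
        (θ • deriv (fun s => g (w, s, p)) θ) 1 := by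
      have h1 : HasDerivAt (fun s => g (w, s, p)) (deriv (fun s => g (w, s, p)) θ)
          (((1 : ℝ) : ℂ) * θ) := by
        have := (hcurve w p _ (hmem 1 (by norm_num))).differentiableAt.hasDerivAt
        simpa using this
      have h2 : HasDerivAt (fun r : ℝ => (r : ℂ) * θ) θ 1 := by
        simpa using (Complex.ofRealCLM.hasDerivAt (x := (1 : ℝ))).mul_const θ
      exact h1.scomp (1 : ℝ) h2
    have := hd2.unique hd1
    simpa [hH] using smul_right_injective E hθ this
  filter_upwards [Metric.ball_mem_nhds _ (half_pos hε)] with q hq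
  have hqε : q ∈ Metric.ball (e₀, (0 : ℂ), p₀) ε := Metric.ball_subset_ball (by linarith) hq
  obtain ⟨w, θ, p⟩ := q
  have hda := hcurve w p θ hqε
  suffices h : deriv (fun s => g (w, s, p)) θ = F (g (w, θ, p), θ, p) by
    simpa only [h] using hda.differentiableAt.hasDerivAt
  -- At θ = 0 the equation follows from nearby θ ≠ 0, both sides being continuous.
  by_cases hθ : θ = 0
  · have hev : ∀ᶠ s in 𝓝[≠] θ, deriv (fun s => g (w, s, p)) s = F (g (w, s, p), s, p) := by
      have hc : ContinuousAt (fun s : ℂ => (w, s, p)) θ := by fun_prop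
      filter_upwards [self_mem_nhdsWithin, nhdsWithin_le_nhds
        (hc.eventually (Metric.isOpen_ball.mem_nhds hq))] with s hs hs'
      exact hne w s p (by simpa [hθ] using hs) hs'
    exact ((hda.deriv.continuousAt.eventuallyEq_nhds_iff_eventuallyEq_nhdsNE
      (hFcurve w p θ hqε)).1 hev).self_of_nhds
  · exact hne w θ p hθ hq

end Flow

namespace EvoCov

noncomputable section

/-! ### Analytic germs of finite order and their line derivatives -/

section FiniteOrder

variable {m q : ℕ} {V V' : Type*} [NormedAddCommGroup V] [NormedSpace ℂ V]
  [NormedAddCommGroup V'] [NormedSpace ℂ V']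

/-- Forget the coordinates `u^i_k` with `k > n`, keeping `w`. -/
def proj (n : ℕ) : Tot m q →L[ℂ] FinJet m n × (Fin q → ℂ) where
  toFun z := (trunc n z.1, z.2)
  map_add' _ _ := rfl
  map_smul' _ _ := rfl
  cont := by unfold trunc; fun_prop

theorem proj_apply (n : ℕ) (z : Tot m q) : proj n z = (trunc n z.1, z.2) := rfl

/-- Forget the coordinates `u^i_k` with `n < k ≤ n'`. -/
def restr {n n' : ℕ} (h : n ≤ n') :
    FinJet m n' × (Fin q → ℂ) →L[ℂ] FinJet m n × (Fin q → ℂ) where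
  toFun v := ((v.1.1, v.1.2.1, fun i k => v.1.2.2 i (Fin.castLE (by omega) k)), v.2)
  map_add' _ _ := rfl
  map_smul' _ _ := rfl
  cont := by fun_prop

/-- Germs of analytic functions that depend on finitely many of the variables `u^i_k`. -/
def FinAnalyticAt (f : Tot m q → V) (z : Tot m q) : Prop :=
  ∃ (n : ℕ) (φ : FinJet m n × (Fin q → ℂ) → V),
    AnalyticAt ℂ φ (proj n z) ∧ f =ᶠ[𝓝 z] φ ∘ proj n

namespace FinAnalyticAt

variable {f : Tot m q → V} {z : Tot m q}

/-- Raising the order lets several germs be factored through one common truncation. -/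
theorem exists_ge (hf : FinAnalyticAt f z) : ∃ N, ∀ n ≥ N,
    ∃ φ : FinJet m n × (Fin q → ℂ) → V, AnalyticAt ℂ φ (proj n z) ∧ f =ᶠ[𝓝 z] φ ∘ proj n := by
  obtain ⟨N, φ, hφ, hfφ⟩ := hf
  refine ⟨N, fun n hn => ⟨φ ∘ restr hn, ?_, hfφ⟩⟩
  exact AnalyticAt.comp (f := restr hn) hφ ((restr hn).analyticAt _)

theorem congr {g : Tot m q → V} (hf : FinAnalyticAt f z) (h : f =ᶠ[𝓝 z] g) :
    FinAnalyticAt g z := by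
  obtain ⟨n, φ, hφ, hfφ⟩ := hf
  exact ⟨n, φ, hφ, h.symm.trans hfφ⟩

theorem eventually [CompleteSpace V] (hf : FinAnalyticAt f z) :
    ∀ᶠ z' in 𝓝 z, FinAnalyticAt f z' := by
  obtain ⟨n, φ, hφ, hfφ⟩ := hf
  filter_upwards [(proj n).continuous.continuousAt.eventually hφ.eventually_analyticAt,
    hfφ.eventually_nhds] with z' h1 h2
  exact ⟨n, φ, h1, h2⟩

theorem of_factor {n : ℕ} {φ : FinJet m n × (Fin q → ℂ) → V} (hφ : AnalyticAt ℂ φ (proj n z)) :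
    FinAnalyticAt (fun z => φ (proj n z)) z :=
  ⟨n, φ, hφ, EventuallyEq.rfl⟩

theorem continuousAt (hf : FinAnalyticAt f z) : ContinuousAt f z := by
  obtain ⟨n, φ, hφ, hfφ⟩ := hf
  exact (ContinuousAt.comp hφ.continuousAt (proj n).continuous.continuousAt).congr hfφ.symm

/-- The Fréchet derivative lives on the finite-dimensional factor. It makes the line derivative
linear in the direction, even though the jet space itself carries no norm. -/
theorem hasLineDerivAt_of_factor {n : ℕ} {φ : FinJet m n × (Fin q → ℂ) → V}
    {L : FinJet m n × (Fin q → ℂ) →L[ℂ] V}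
    (hφ : HasFDerivAt φ L (proj n z)) (hf : f =ᶠ[𝓝 z] φ ∘ proj n) (ζ : Tot m q) :
    HasLineDerivAt ℂ f (L (proj n ζ)) z ζ := by
  have h1 : HasDerivAt (fun t : ℂ => φ (proj n z + t • proj n ζ)) (L (proj n ζ)) 0 :=
    hφ.hasLineDerivAt (proj n ζ)
  have hc : ContinuousAt (fun t : ℂ => z + t • ζ) 0 := by fun_prop
  have h2 : ∀ᶠ t : ℂ in 𝓝 0, f (z + t • ζ) = φ (proj n z + t • proj n ζ) := by
    have h3 : ∀ᶠ z' in 𝓝 (z + (0 : ℂ) • ζ), f z' = φ (proj n z') := by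
      rw [zero_smul, add_zero]; exact hf
    filter_upwards [hc.eventually h3] with t ht
    rw [ht, map_add, map_smul]
  exact h1.congr_of_eventuallyEq h2

theorem exists_deriv (hf : FinAnalyticAt f z) :
    ∃ L : Tot m q →L[ℂ] V, ∀ ζ, HasLineDerivAt ℂ f (L ζ) z ζ := by
  obtain ⟨n, φ, hφ, hfφ⟩ := hf
  exact ⟨(fderiv ℂ φ (proj n z)).comp (proj n), fun ζ =>
    hasLineDerivAt_of_factor hφ.differentiableAt.hasFDerivAt hfφ ζ⟩

theorem hasLineDerivAt (hf : FinAnalyticAt f z) (ζ : Tot m q) :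
    HasLineDerivAt ℂ f (lineDeriv ℂ f z ζ) z ζ := by
  obtain ⟨L, hL⟩ := hf.exists_deriv
  exact (hL ζ).lineDeriv.symm ▸ hL ζ

theorem lineDeriv_add (hf : FinAnalyticAt f z) (ζ η : Tot m q) :
    lineDeriv ℂ f z (ζ + η) = lineDeriv ℂ f z ζ + lineDeriv ℂ f z η := by
  obtain ⟨L, hL⟩ := hf.exists_deriv
  simp only [(hL _).lineDeriv, map_add]

/-- One neighborhood serves all directions at once, which matters because there are infinitely many
u^i_k. -/
theorem lineDeriv_eventually_eq [CompleteSpace V] {n : ℕ} {φ : FinJet m n × (Fin q → ℂ) → V}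
    (hφ : AnalyticAt ℂ φ (proj n z)) (hf : f =ᶠ[𝓝 z] φ ∘ proj n) :
    ∀ᶠ z' in 𝓝 z, ∀ ζ, lineDeriv ℂ f z' ζ = fderiv ℂ φ (proj n z') (proj n ζ) := by
  filter_upwards [(proj n).continuous.continuousAt.eventually hφ.eventually_analyticAt,
    hf.eventually_nhds] with z' h1 h2 ζ
  exact (hasLineDerivAt_of_factor h1.differentiableAt.hasFDerivAt h2 ζ).lineDeriv

theorem const (c : V) : FinAnalyticAt (fun _ : Tot m q => c) z :=
  of_factor (n := 0) (φ := fun _ => c) analyticAt_const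

theorem analytic_comp {Φ : V → V'} (hΦ : AnalyticAt ℂ Φ (f z)) (hf : FinAnalyticAt f z) :
    FinAnalyticAt (fun z => Φ (f z)) z := by
  obtain ⟨n, φ, hφ, hfφ⟩ := hf
  have h0 : f z = φ (proj n z) := hfφ.self_of_nhds
  refine ⟨n, Φ ∘ φ, AnalyticAt.comp (h0 ▸ hΦ) hφ, ?_⟩
  filter_upwards [hfφ] with z' hz'
  simp [hz']

theorem prodMk {g : Tot m q → V'} (hf : FinAnalyticAt f z) (hg : FinAnalyticAt g z) :
    FinAnalyticAt (fun z => (f z, g z)) z := by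
  obtain ⟨n₁, h₁⟩ := hf.exists_ge
  obtain ⟨n₂, h₂⟩ := hg.exists_ge
  obtain ⟨φ, hφ, hfφ⟩ := h₁ (max n₁ n₂) (le_max_left _ _)
  obtain ⟨ψ, hψ, hgψ⟩ := h₂ (max n₁ n₂) (le_max_right _ _)
  exact ⟨_, fun v => (φ v, ψ v), hφ.prod hψ, hfφ.prodMk hgψ⟩

theorem pi {ι : Type*} [Fintype ι] {W : ι → Type*} [∀ i, NormedAddCommGroup (W i)]
    [∀ i, NormedSpace ℂ (W i)] {f : ∀ i, Tot m q → W i}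
    (hf : ∀ i, FinAnalyticAt (f i) z) : FinAnalyticAt (fun z i => f i z) z := by
  choose N hN using fun i => (hf i).exists_ge
  choose φ hφ hfφ using fun i => hN i (Finset.univ.sup N) (Finset.le_sup (Finset.mem_univ i))
  refine ⟨Finset.univ.sup N, fun v i => φ i v, AnalyticAt.pi hφ, ?_⟩
  filter_upwards [eventually_all.2 hfφ] with z' hz'
  funext i
  exact hz' i

theorem sub {g : Tot m q → V} (hf : FinAnalyticAt f z) (hg : FinAnalyticAt g z) :
    FinAnalyticAt (fun z => f z - g z) z :=
  analytic_comp (Φ := fun v : V × V => v.1 - v.2) (analyticAt_fst.sub analyticAt_snd)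
    (hf.prodMk hg)

theorem clm_apply {c : Tot m q → V →L[ℂ] V'} (hc : FinAnalyticAt c z) (hf : FinAnalyticAt f z) :
    FinAnalyticAt (fun z => c z (f z)) z :=
  analytic_comp (Φ := fun v : (V →L[ℂ] V') × V => v.1 v.2)
    ((ContinuousLinearMap.analyticAt_bilinear (ContinuousLinearMap.id ℂ (V →L[ℂ] V')) _))
    (hc.prodMk hf)

end FinAnalyticAt

theorem HasLineDerivAt.analytic_comp {f : Tot m q → V} {z ζ : Tot m q} {v : V} {Φ : V → V'}
    (hΦ : DifferentiableAt ℂ Φ (f z)) (hf : HasLineDerivAt ℂ f v z ζ) :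
    HasLineDerivAt ℂ (fun z => Φ (f z)) (fderiv ℂ Φ (f z) v) z ζ := by
  have h : HasFDerivAt Φ (fderiv ℂ Φ (f z)) (f (z + (0 : ℂ) • ζ)) := by
    simpa using hΦ.hasFDerivAt
  exact h.comp_hasDerivAt 0 hf

theorem finAnalyticAt_fst_x (z : Tot m q) : FinAnalyticAt (fun z : Tot m q => z.1.1) z :=
  .of_factor (n := 0) (φ := fun v => v.1.1) (analyticAt_fst.fun_comp analyticAt_fst)

theorem finAnalyticAt_fst_t (z : Tot m q) : FinAnalyticAt (fun z : Tot m q => z.1.2.1) z :=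
  .of_factor (n := 0) (φ := fun v => v.1.2.1)
    (analyticAt_fst.fun_comp (analyticAt_snd.fun_comp analyticAt_fst))

theorem finAnalyticAt_fst_u (i : Fin m) (k : ℕ) (z : Tot m q) :
    FinAnalyticAt (fun z : Tot m q => z.1.2.2 i k) z := by
  let L : FinJet m k × (Fin q → ℂ) →L[ℂ] ℂ :=
    { toFun := fun v => v.1.2.2 i (Fin.last k)
      map_add' := fun _ _ => rfl
      map_smul' := fun _ _ => rfl
      cont := by fun_prop }
  exact .of_factor (n := k) (φ := L) (L.analyticAt _)

theorem finAnalyticAt_snd (z : Tot m q) : FinAnalyticAt (fun z : Tot m q => z.2) z :=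
  .of_factor (n := 0) (φ := fun v => v.2) analyticAt_snd

end FiniteOrder
-- Vector fields with infinitely many components, and their commutators
section Maps

variable {m q : ℕ} {V : Type*} [NormedAddCommGroup V] [NormedSpace ℂ V]

/-- Maps of the total space all of whose components are analytic germs of finite order. -/
structure FinAnalyticMapAt (X : Tot m q → Tot m q) (z : Tot m q) : Prop where
  x : FinAnalyticAt (fun z => (X z).1.1) z
  t : FinAnalyticAt (fun z => (X z).1.2.1) z
  u : ∀ i k, FinAnalyticAt (fun z => (X z).1.2.2 i k) z
  w : FinAnalyticAt (fun z => (X z).2) z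

/-- The derivative of a map of the total space in a given direction, taken componentwise. -/
def mapDeriv (X : Tot m q → Tot m q) (z ζ : Tot m q) : Tot m q :=
  ((lineDeriv ℂ (fun z => (X z).1.1) z ζ, lineDeriv ℂ (fun z => (X z).1.2.1) z ζ,
    fun i k => lineDeriv ℂ (fun z => (X z).1.2.2 i k) z ζ), lineDeriv ℂ (fun z => (X z).2) z ζ)

namespace FinAnalyticMapAt

variable {X Y : Tot m q → Tot m q} {z : Tot m q}

/-- The orders of the components of X may be unbounded, as for D_x and D_t; a truncation sees only
finitely many of them. -/
theorem proj_comp (hX : FinAnalyticMapAt X z) (n : ℕ) : FinAnalyticAt (fun z => proj n (X z)) z :=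
  have hu : FinAnalyticAt (fun z (i : Fin m) (k : Fin (n + 1)) => (X z).1.2.2 i k) z :=
    .pi fun i => .pi fun k => hX.u i k
  (hX.x.prodMk (hX.t.prodMk hu)).prodMk hX.w

theorem hasLineDerivAt_proj (hX : FinAnalyticMapAt X z) (n : ℕ) (ζ : Tot m q) :
    HasLineDerivAt ℂ (fun z => proj n (X z)) (proj n (mapDeriv X z ζ)) z ζ :=
  have hu : HasLineDerivAt ℂ (fun z (i : Fin m) (k : Fin (n + 1)) => (X z).1.2.2 i k)
      (fun (i : Fin m) (k : Fin (n + 1)) => (mapDeriv X z ζ).1.2.2 i k) z ζ :=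
    hasDerivAt_pi.2 fun i => hasDerivAt_pi.2 fun k => (hX.u i k).hasLineDerivAt ζ
  ((hX.x.hasLineDerivAt ζ).prodMk ((hX.t.hasLineDerivAt ζ).prodMk hu)).prodMk
      (hX.w.hasLineDerivAt ζ)

theorem continuousAt (hX : FinAnalyticMapAt X z) : ContinuousAt X z :=
  (hX.x.continuousAt.prodMk (hX.t.continuousAt.prodMk
    (continuousAt_pi.2 fun i => continuousAt_pi.2 fun k => (hX.u i k).continuousAt))).prodMk
      hX.w.continuousAt

end FinAnalyticMapAt

namespace FinAnalyticAt

variable {f : Tot m q → V} {X Y : Tot m q → Tot m q} {z : Tot m q}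

theorem map_comp (hf : FinAnalyticAt f (X z)) (hX : FinAnalyticMapAt X z) :
    FinAnalyticAt (fun z => f (X z)) z := by
  obtain ⟨n, φ, hφ, hfφ⟩ := hf
  have h : (fun z => f (X z)) =ᶠ[𝓝 z] fun z => φ (proj n (X z)) := hX.continuousAt.eventually hfφ
  exact (analytic_comp (f := fun z => proj n (X z)) hφ (hX.proj_comp n)).congr h.symm

theorem hasLineDerivAt_map_comp (hf : FinAnalyticAt f (X z)) (hX : FinAnalyticMapAt X z)
    (ζ : Tot m q) :
    HasLineDerivAt ℂ (fun z => f (X z)) (lineDeriv ℂ f (X z) (mapDeriv X z ζ)) z ζ := by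
  obtain ⟨n, φ, hφ, hfφ⟩ := hf
  have h1 := HasLineDerivAt.analytic_comp (f := fun z => proj n (X z)) hφ.differentiableAt
    (hX.hasLineDerivAt_proj n ζ)
  rw [(hasLineDerivAt_of_factor hφ.differentiableAt.hasFDerivAt hfφ _).lineDeriv]
  have hc : ContinuousAt (fun t : ℂ => z + t • ζ) 0 := by fun_prop
  have h3 : ∀ᶠ z' in 𝓝 (z + (0 : ℂ) • ζ), f (X z') = φ (proj n (X z')) := by
    rw [zero_smul, add_zero]; exact hX.continuousAt.eventually hfφ
  exact HasDerivAt.congr_of_eventuallyEq h1 (hc.eventually h3)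

theorem lineDeriv_map_comp (hf : FinAnalyticAt f (X z)) (hX : FinAnalyticMapAt X z)
    (ζ : Tot m q) :
    lineDeriv ℂ (fun z => f (X z)) z ζ = lineDeriv ℂ f (X z) (mapDeriv X z ζ) :=
  (hf.hasLineDerivAt_map_comp hX ζ).lineDeriv

theorem lineDeriv_field [CompleteSpace V] (hf : FinAnalyticAt f z) (hX : FinAnalyticMapAt X z) :
    FinAnalyticAt (fun z => lineDeriv ℂ f z (X z)) z := by
  obtain ⟨n, φ, hφ, hfφ⟩ := hf
  refine FinAnalyticAt.congr (f := fun z => fderiv ℂ φ (proj n z) (proj n (X z))) ?_ ?_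
  · exact (FinAnalyticAt.of_factor hφ.fderiv).clm_apply (hX.proj_comp n)
  · filter_upwards [lineDeriv_eventually_eq hφ hfφ] with z' hz' using (hz' _).symm

/-- The product rule, with the second-derivative term separated out so that it can cancel in a
commutator by symmetry. -/
theorem hasLineDerivAt_lineDeriv_field [CompleteSpace V] {n : ℕ} {φ : FinJet m n × (Fin q → ℂ) → V}
    (hφ : AnalyticAt ℂ φ (proj n z)) (hfφ : f =ᶠ[𝓝 z] φ ∘ proj n)
    (hX : FinAnalyticMapAt X z) (ζ : Tot m q) :
    HasLineDerivAt ℂ (fun z => lineDeriv ℂ f z (X z))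
      (fderiv ℂ (fderiv ℂ φ) (proj n z) (proj n ζ) (proj n (X z)) +
        fderiv ℂ φ (proj n z) (proj n (mapDeriv X z ζ))) z ζ := by
  have h1 : HasLineDerivAt ℂ (fun z => fderiv ℂ φ (proj n z))
      (fderiv ℂ (fderiv ℂ φ) (proj n z) (proj n ζ)) z ζ :=
    hasLineDerivAt_of_factor hφ.fderiv.differentiableAt.hasFDerivAt EventuallyEq.rfl ζ
  have h2 := HasDerivAt.clm_apply h1 (hX.hasLineDerivAt_proj n ζ)
  simp only [zero_smul, add_zero] at h2
  have hc : ContinuousAt (fun t : ℂ => z + t • ζ) 0 := by fun_prop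
  have h3 : ∀ᶠ z' in 𝓝 (z + (0 : ℂ) • ζ),
      lineDeriv ℂ f z' (X z') = fderiv ℂ φ (proj n z') (proj n (X z')) := by
    rw [zero_smul, add_zero]
    filter_upwards [lineDeriv_eventually_eq hφ hfφ] with z' hz' using hz' _
  exact HasDerivAt.congr_of_eventuallyEq h2 (hc.eventually h3)

/-- The commutator of two vector fields, applied to a function. -/
theorem lineDeriv_commutator [CompleteSpace V] (hf : FinAnalyticAt f z) (hX : FinAnalyticMapAt X z)
    (hY : FinAnalyticMapAt Y z) :
    lineDeriv ℂ (fun z => lineDeriv ℂ f z (Y z)) z (X z) -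
      lineDeriv ℂ (fun z => lineDeriv ℂ f z (X z)) z (Y z) =
    lineDeriv ℂ f z (mapDeriv Y z (X z) - mapDeriv X z (Y z)) := by
  obtain ⟨n, φ, hφ, hfφ⟩ := hf
  have hsymm : IsSymmSndFDerivAt ℂ φ (proj n z) :=
    (hφ.contDiffAt (n := minSmoothness ℂ 2)).isSymmSndFDerivAt le_rfl
  rw [(hasLineDerivAt_lineDeriv_field hφ hfφ hY (X z)).lineDeriv,
    (hasLineDerivAt_lineDeriv_field hφ hfφ hX (Y z)).lineDeriv,
    (hasLineDerivAt_of_factor hφ.differentiableAt.hasFDerivAt hfφ _).lineDeriv,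
    hsymm.eq, map_sub, map_sub]
  abel

end FinAnalyticAt

/-- The unit vector of the coordinate `u^i_k`. -/
def unitU (i : Fin m) (k : ℕ) : Jet m := (0, 0, Pi.single i (Pi.single k 1))

variable {f : Tot m q → V}

theorem setU_eq (y : Jet m) (i : Fin m) (k : ℕ) (s : ℂ) :
    setU y i k (y.2.2 i k + s) = y + s • unitU i k := by
  refine Prod.ext (by simp [setU, unitU]) (Prod.ext (by simp [setU, unitU]) ?_)
  funext j l
  by_cases hj : j = i
  · subst hj
    by_cases hl : l = k
    · subst hl; simp [setU, unitU]
    · simp [setU, unitU, hl]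
  · simp [setU, unitU, hj]

theorem pdu_eq_lineDeriv (i : Fin m) (k : ℕ) (z : Tot m q) :
    pdu i k (fun y => f (y, z.2)) z.1 = lineDeriv ℂ f z (unitU i k, 0) := by
  have := deriv_comp_const_add (f := fun s : ℂ => f (setU z.1 i k s, z.2)) (z.1.2.2 i k) 0
  rw [add_zero] at this
  rw [pdu, ← this, lineDeriv]
  congr 1
  funext s
  rw [setU_eq]
  congr 1
  simp [Prod.ext_iff]

theorem pdx_eq_lineDeriv (z : Tot m q) :
    pdx (fun y => f (y, z.2)) z.1 = lineDeriv ℂ f z ((1, 0, 0), 0) := by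
  have := deriv_comp_const_add (f := fun s : ℂ => f ((s, z.1.2.1, z.1.2.2), z.2)) z.1.1 0
  rw [add_zero] at this
  rw [pdx, ← this, lineDeriv]
  congr 1
  funext s
  congr 1
  simp [Prod.ext_iff]

theorem pdt_eq_lineDeriv (z : Tot m q) :
    pdt (fun y => f (y, z.2)) z.1 = lineDeriv ℂ f z ((0, 1, 0), 0) := by
  have := deriv_comp_const_add (f := fun s : ℂ => f ((z.1.1, s, z.1.2.2), z.2)) z.1.2.1 0
  rw [add_zero] at this
  rw [pdt, ← this, lineDeriv]
  congr 1
  funext s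
  congr 1
  simp [Prod.ext_iff]

theorem proj_unitU_eq_zero {n k : ℕ} (hk : n < k) (i : Fin m) :
    proj (q := q) n (unitU i k, 0) = 0 := by
  refine Prod.ext (Prod.ext rfl (Prod.ext rfl ?_)) rfl
  funext j l
  have hl : (l : ℕ) ≠ k := by have := l.2; omega
  by_cases hj : j = i
  · subst hj; simp [proj_apply, trunc, unitU, hl]
  · simp [proj_apply, trunc, unitU, hj]

/-- Truncation kills the unit vectors of high index, so the sum is finite and linearity applies,
although c may have infinitely many nonzero entries. This turns the formal sums in D_x and D_t into
single line derivatives. -/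
theorem FinAnalyticAt.finsum_lineDeriv_unitU {z : Tot m q} (hf : FinAnalyticAt f z)
    (c : Fin m → ℕ → ℂ) :
    ∑ᶠ ik : Fin m × ℕ, c ik.1 ik.2 • lineDeriv ℂ f z (unitU ik.1 ik.2, 0) =
      lineDeriv ℂ f z ((0, 0, c), 0) := by
  obtain ⟨n, φ, hφ, hfφ⟩ := hf
  have hL : ∀ ζ, lineDeriv ℂ f z ζ = fderiv ℂ φ (proj n z) (proj n ζ) := fun ζ =>
    (hasLineDerivAt_of_factor hφ.differentiableAt.hasFDerivAt hfφ ζ).lineDeriv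
  simp only [hL]
  rw [finsum_eq_sum_of_support_subset (s := Finset.univ ×ˢ Finset.range (n + 1))]
  · simp only [← map_smul, ← map_sum]
    congr 1
    rw [map_sum]
    refine Prod.ext (Prod.ext ?_ (Prod.ext ?_ ?_)) ?_
    · rw [Prod.fst_sum, Prod.fst_sum]
      exact Finset.sum_eq_zero fun x _ => by simp [proj_apply, trunc, unitU]
    · rw [Prod.fst_sum, Prod.snd_sum, Prod.fst_sum]
      exact Finset.sum_eq_zero fun x _ => by simp [proj_apply, trunc, unitU]
    · rw [Prod.fst_sum, Prod.snd_sum, Prod.snd_sum]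
      funext j l
      rw [Finset.sum_apply, Finset.sum_apply, Finset.sum_eq_single (j, (l : ℕ))]
      · simp [proj_apply, trunc, unitU]
      · rintro ⟨i, k⟩ _ hne
        by_cases hj : j = i
        · subst hj
          have hl : (l : ℕ) ≠ k := fun h => hne (by rw [h])
          simp [proj_apply, trunc, unitU, hl]
        · simp [proj_apply, trunc, unitU, hj]
      · intro h
        exact absurd (by simpa using Nat.lt_succ_iff.1 l.2) h
    · rw [Prod.snd_sum]
      exact Finset.sum_eq_zero fun x _ => by simp [proj_apply]
  · intro ik hik
    by_contra hk
    apply hik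
    have : n < ik.2 := by simpa using hk
    simp [proj_unitU_eq_zero this]

end Maps
-- The total derivative D_x as a line derivative
section Fields

variable {m q : ℕ} {V : Type*} [NormedAddCommGroup V] [NormedSpace ℂ V]

theorem hasLineDerivAt_u (i : Fin m) (k : ℕ) (z ζ : Tot m q) :
    HasLineDerivAt ℂ (fun z : Tot m q => z.1.2.2 i k) (ζ.1.2.2 i k) z ζ := by
  have h : HasDerivAt (fun s : ℂ => z.1.2.2 i k + s * ζ.1.2.2 i k) (ζ.1.2.2 i k) 0 := by
    simpa using ((hasDerivAt_id (0 : ℂ)).mul_const (ζ.1.2.2 i k)).const_add (z.1.2.2 i k)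
  exact h

theorem hasLineDerivAt_x (z ζ : Tot m q) :
    HasLineDerivAt ℂ (fun z : Tot m q => z.1.1) ζ.1.1 z ζ := by
  have h : HasDerivAt (fun s : ℂ => z.1.1 + s * ζ.1.1) ζ.1.1 0 := by
    simpa using ((hasDerivAt_id (0 : ℂ)).mul_const ζ.1.1).const_add z.1.1
  exact h

theorem hasLineDerivAt_t (z ζ : Tot m q) :
    HasLineDerivAt ℂ (fun z : Tot m q => z.1.2.1) ζ.1.2.1 z ζ := by
  have h : HasDerivAt (fun s : ℂ => z.1.2.1 + s * ζ.1.2.1) ζ.1.2.1 0 := by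
    simpa using ((hasDerivAt_id (0 : ℂ)).mul_const ζ.1.2.1).const_add z.1.2.1
  exact h

theorem lineDeriv_const' (c : V) (z ζ : Tot m q) : lineDeriv ℂ (fun _ => c) z ζ = 0 := by
  simp [lineDeriv]

theorem lineDeriv_congr {f g : Tot m q → V} {z : Tot m q} (h : f =ᶠ[𝓝 z] g) (ζ : Tot m q) :
    lineDeriv ℂ f z ζ = lineDeriv ℂ g z ζ := by
  have hc : ContinuousAt (fun t : ℂ => z + t • ζ) 0 := by fun_prop
  have h3 : ∀ᶠ z' in 𝓝 (z + (0 : ℂ) • ζ), f z' = g z' := by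
    rw [zero_smul, add_zero]; exact h
  exact EventuallyEq.deriv_eq (hc.eventually h3)

/-- The coefficients of the vector field `D_x`. -/
def fieldX (y : Jet m) : Jet m := (1, 0, fun i k => y.2.2 i (k + 1))

theorem Dx_eq_lineDeriv {f : Tot m q → V} {z : Tot m q} (hf : FinAnalyticAt f z) :
    Dx (fun y => f (y, z.2)) z.1 = lineDeriv ℂ f z (fieldX z.1, 0) := by
  simp only [Dx, pdx_eq_lineDeriv, pdu_eq_lineDeriv]
  rw [hf.finsum_lineDeriv_unitU fun i k => z.1.2.2 i (k + 1), ← hf.lineDeriv_add]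
  simp [fieldX]

/-- Germs of vector fields on the jet space with components of finite order. -/
def FinAnalyticFieldAt (c : Jet m → Jet m) (z : Tot m q) : Prop :=
  FinAnalyticMapAt (fun z : Tot m q => (c z.1, (0 : Fin q → ℂ))) z

theorem FinAnalyticFieldAt.lift {c : Jet m → Jet m} {z : Tot m q} (hc : FinAnalyticFieldAt c z)
    {A : Tot m q → Fin q → ℂ} (hA : FinAnalyticAt A z) :
    FinAnalyticMapAt (fun z : Tot m q => (c z.1, A z)) z :=
  ⟨hc.x, hc.t, hc.u, hA⟩

theorem finAnalyticFieldAt_const (e : Jet m) (z : Tot m q) : FinAnalyticFieldAt (fun _ => e) z :=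
  ⟨.const _, .const _, fun _ _ => .const _, .const _⟩

theorem finAnalyticFieldAt_X (z : Tot m q) : FinAnalyticFieldAt fieldX z :=
  ⟨.const _, .const _, fun i k => finAnalyticAt_fst_u i (k + 1) z, .const _⟩

theorem mapDeriv_const (e z ζ : Tot m q) : mapDeriv (fun _ => e) z ζ = 0 := by
  simp only [mapDeriv, lineDeriv_const']
  rfl

theorem mapDeriv_X (A : Tot m q → Fin q → ℂ) (z ζ : Tot m q) :
    mapDeriv (fun z => (fieldX z.1, A z)) z ζ =
      ((0, 0, fun i k => ζ.1.2.2 i (k + 1)), lineDeriv ℂ A z ζ) := by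
  simp only [mapDeriv, fieldX, lineDeriv_const', (hasLineDerivAt_u _ _ z ζ).lineDeriv]

theorem finAnalyticMapAt_gaugeMap {g : Tot m q → Fin q → ℂ} {z : Tot m q}
    (hg : FinAnalyticAt g z) : FinAnalyticMapAt (gaugeMap g) z :=
  ⟨finAnalyticAt_fst_x z, finAnalyticAt_fst_t z, fun i k => finAnalyticAt_fst_u i k z, hg⟩

theorem mapDeriv_gaugeMap (g : Tot m q → Fin q → ℂ) (z ζ : Tot m q) :
    mapDeriv (gaugeMap g) z ζ = (ζ.1, lineDeriv ℂ g z ζ) := by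
  simp only [mapDeriv, gaugeMap, (hasLineDerivAt_u _ _ z ζ).lineDeriv,
    (hasLineDerivAt_x z ζ).lineDeriv, (hasLineDerivAt_t z ζ).lineDeriv]

end Fields

/-! ### The total derivative D_t as a line derivative -/

section TimeField

variable {m q d : ℕ} (S : EvolutionSystem m d)

/-- The coefficients of the vector field `D_t`. -/
def EvolutionSystem.fieldT (y : Jet m) : Jet m := (0, 1, fun i k => (Dx^[k] (S.rhs i)) y)

theorem Dt_eq_lineDeriv {V : Type*} [NormedAddCommGroup V] [NormedSpace ℂ V]
    {f : Tot m q → V} {z : Tot m q} (hf : FinAnalyticAt f z) :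
    S.Dt (fun y => f (y, z.2)) z.1 = lineDeriv ℂ f z (S.fieldT z.1, 0) := by
  simp only [EvolutionSystem.Dt, pdt_eq_lineDeriv, pdu_eq_lineDeriv]
  rw [hf.finsum_lineDeriv_unitU fun i k => (Dx^[k] (S.rhs i)) z.1, ← hf.lineDeriv_add]
  simp [EvolutionSystem.fieldT]

theorem isOpen_prolongation : IsOpen S.prolongation := by
  refine S.isOpen_dom.preimage ?_
  unfold trunc
  fun_prop

theorem finAnalyticAt_iterate_Dx_rhs (i : Fin m) (k : ℕ) {z : Tot m q}
    (hz : z.1 ∈ S.prolongation) : FinAnalyticAt (fun z : Tot m q => (Dx^[k] (S.rhs i)) z.1) z := by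
  induction k generalizing z with
  | zero =>
    have h1 : AnalyticAt ℂ (fun v : FinJet m d × (Fin q → ℂ) => S.F v.1 i) (proj d z) := by
      have h2 : AnalyticAt ℂ S.F (proj d z).1 := S.analytic_F _ hz
      have h3 : AnalyticAt ℂ (fun v : FinJet m d × (Fin q → ℂ) => S.F v.1) (proj d z) :=
        h2.fun_comp analyticAt_fst
      exact ((ContinuousLinearMap.proj (R := ℂ) (φ := fun _ : Fin m => ℂ) i).analyticAt _).fun_comp
        h3
    exact FinAnalyticAt.of_factor h1
  | succ k ih =>
    have hev : ∀ᶠ z' : Tot m q in 𝓝 z, z'.1 ∈ S.prolongation :=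
      continuousAt_fst.eventually ((isOpen_prolongation S).mem_nhds hz)
    refine ((ih hz).lineDeriv_field (finAnalyticFieldAt_X z)).congr ?_
    filter_upwards [hev] with z' hz'
    rw [Function.iterate_succ_apply']
    exact (Dx_eq_lineDeriv (ih hz')).symm

theorem finAnalyticFieldAt_T {z : Tot m q} (hz : z.1 ∈ S.prolongation) :
    FinAnalyticFieldAt S.fieldT z :=
  ⟨.const _, .const _, fun i k => finAnalyticAt_iterate_Dx_rhs S i k hz, .const _⟩

/-- Together with `mapDeriv_X` this expresses [D_x, D_t] = 0: differentiating the coefficients D_x^k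
F along D_x has the same effect as shifting the index of the coefficients of D_t. -/
theorem mapDeriv_T_X {z : Tot m q} (hz : z.1 ∈ S.prolongation) (A B : Tot m q → Fin q → ℂ) :
    mapDeriv (fun z => (S.fieldT z.1, B z)) z (fieldX z.1, A z) =
      ((0, 0, fun i k => (Dx^[k + 1] (S.rhs i)) z.1), lineDeriv ℂ B z (fieldX z.1, A z)) := by
  have h : ∀ i k, lineDeriv ℂ (fun z : Tot m q => (Dx^[k] (S.rhs i)) z.1) z (fieldX z.1, A z) =
      (Dx^[k + 1] (S.rhs i)) z.1 := by
    intro i k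
    rw [Function.iterate_succ_apply']
    exact (Dx_eq_lineDeriv (finAnalyticAt_iterate_Dx_rhs S i k hz)).symm
  simp only [mapDeriv, EvolutionSystem.fieldT, lineDeriv_const', h]

end TimeField

/-! ### Transformation of fields under a gauge -/

section Gauge

variable {m q : ℕ}

theorem hasFDerivAt_snd_of_factor {g : Tot m q → Fin q → ℂ} {z : Tot m q} {n : ℕ}
    {φ : FinJet m n × (Fin q → ℂ) → Fin q → ℂ}
    (hφ : DifferentiableAt ℂ φ (proj n z)) (hg : g =ᶠ[𝓝 z] φ ∘ proj n) :
    HasFDerivAt (fun w => g (z.1, w))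
      ((fderiv ℂ φ (proj n z)).comp (ContinuousLinearMap.inr ℂ (FinJet m n) (Fin q → ℂ))) z.2 := by
  have h1 : HasFDerivAt (fun w => φ (trunc n z.1, w))
      ((fderiv ℂ φ (proj n z)).comp (ContinuousLinearMap.inr ℂ (FinJet m n) (Fin q → ℂ))) z.2 :=
    HasFDerivAt.comp z.2 hφ.hasFDerivAt (hasFDerivAt_prodMk_right (trunc n z.1) z.2)
  refine h1.congr_of_eventuallyEq ?_
  have hc : ContinuousAt (fun w => (z.1, w)) z.2 := by fun_prop
  exact hc.eventually hg

theorem FinAnalyticAt.jac_apply {g : Tot m q → Fin q → ℂ} {z : Tot m q} (hg : FinAnalyticAt g z)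
    (v : Fin q → ℂ) : jac g z v = lineDeriv ℂ g z (0, v) := by
  obtain ⟨n, φ, hφ, hgφ⟩ := hg
  rw [jac, (hasFDerivAt_snd_of_factor hφ.differentiableAt hgφ).fderiv,
    (hasLineDerivAt_of_factor hφ.differentiableAt.hasFDerivAt hgφ _).lineDeriv]
  rfl

theorem FinAnalyticAt.jac {g : Tot m q → Fin q → ℂ} {z : Tot m q} (hg : FinAnalyticAt g z) :
    FinAnalyticAt (jac g) z := by
  obtain ⟨n, φ, hφ, hgφ⟩ := hg
  refine FinAnalyticAt.congr (f := fun z => (fderiv ℂ φ (proj n z)).comp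
    (ContinuousLinearMap.inr ℂ (FinJet m n) (Fin q → ℂ))) ?_ ?_
  · refine FinAnalyticAt.analytic_comp (f := fun z => fderiv ℂ φ (proj n z))
      (Φ := fun L => L.comp (ContinuousLinearMap.inr ℂ (FinJet m n) (Fin q → ℂ))) ?_
      (.of_factor hφ.fderiv)
    exact ((ContinuousLinearMap.compL ℂ (Fin q → ℂ) (FinJet m n × (Fin q → ℂ)) (Fin q → ℂ)).flip
      (ContinuousLinearMap.inr ℂ (FinJet m n) (Fin q → ℂ))).analyticAt _
  · filter_upwards [(proj n).continuous.continuousAt.eventually hφ.eventually_analyticAt,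
      hgφ.eventually_nhds] with z' h1 h2
    exact (hasFDerivAt_snd_of_factor h1.differentiableAt h2).fderiv.symm

theorem FinAnalyticAt.lineDeriv_eq_add_jac {g : Tot m q → Fin q → ℂ} {z : Tot m q}
    (hg : FinAnalyticAt g z) (ζ : Tot m q) :
    lineDeriv ℂ g z ζ = lineDeriv ℂ g z (ζ.1, 0) + EvoCov.jac g z ζ.2 := by
  rw [hg.jac_apply, ← hg.lineDeriv_add]
  simp

/-- The transform of a vector field `c + A`, where `c` is a field on the jet space. -/
def gaugeField (c : Jet m → Jet m) (g A : Tot m q → Fin q → ℂ) (z : Tot m q) : Fin q → ℂ :=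
  (jac g z).inverse (A (gaugeMap g z) - lineDeriv ℂ g z (c z.1, 0))

theorem gaugeA_eq_gaugeField {g : Tot m q → Fin q → ℂ} {z : Tot m q} (hg : FinAnalyticAt g z)
    (A : Tot m q → Fin q → ℂ) : gaugeA g A z = gaugeField fieldX g A z := by
  rw [gaugeA, gaugeField, Dx_eq_lineDeriv hg]

theorem gaugeB_eq_gaugeField {d : ℕ} (S : EvolutionSystem m d) {g : Tot m q → Fin q → ℂ}
    {z : Tot m q} (hg : FinAnalyticAt g z)
    (B : Tot m q → Fin q → ℂ) : gaugeB S g B z = gaugeField S.fieldT g B z := by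
  rw [gaugeB, gaugeField, Dt_eq_lineDeriv S hg]

/-- Germs of finite order with invertible Jacobian `∂g/∂w`. -/
structure RegularAt (g : Tot m q → Fin q → ℂ) (z : Tot m q) : Prop where
  analytic : FinAnalyticAt g z
  invertible : (jac g z).IsInvertible

namespace RegularAt

variable {g h A : Tot m q → Fin q → ℂ} {c : Jet m → Jet m} {z : Tot m q}

theorem jac_inverse (hg : RegularAt g z) (v : Fin q → ℂ) : jac g z ((jac g z).inverse v) = v := by
  obtain ⟨e, he⟩ := hg.invertible
  rw [← he, ContinuousLinearMap.inverse_equiv]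
  simp

theorem inverse_jac (hg : RegularAt g z) (v : Fin q → ℂ) : (jac g z).inverse (jac g z v) = v := by
  obtain ⟨e, he⟩ := hg.invertible
  rw [← he, ContinuousLinearMap.inverse_equiv]
  simp

theorem jac_eq_zero (hg : RegularAt g z) {v : Fin q → ℂ} (hv : jac g z v = 0) : v = 0 := by
  rw [← hg.inverse_jac v, hv, map_zero]

theorem eventually (hg : RegularAt g z) : ∀ᶠ z' in 𝓝 z, RegularAt g z' := by
  obtain ⟨e, he⟩ := hg.invertible
  have hn : ∀ᶠ z' in 𝓝 z, ∃ e : (Fin q → ℂ) ≃L[ℂ] (Fin q → ℂ), e = jac g z' := by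
    have := e.nhds
    rw [he] at this
    exact hg.analytic.jac.continuousAt this
  filter_upwards [hg.analytic.eventually, hn] with z' h1 h2 using ⟨h1, h2⟩

/-- The gauge map intertwines the transformed field with the original one. Together with the
converse `eq_gaugeField` this replaces the formula with the inverse Jacobian in later arguments. -/
theorem lineDeriv_gaugeField (hg : RegularAt g z) :
    lineDeriv ℂ g z (c z.1, gaugeField c g A z) = A (gaugeMap g z) := by
  rw [hg.analytic.lineDeriv_eq_add_jac, gaugeField, hg.jac_inverse]
  abel

theorem eq_gaugeField (hg : RegularAt g z) {α : Fin q → ℂ}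
    (hα : lineDeriv ℂ g z (c z.1, α) = A (gaugeMap g z)) : α = gaugeField c g A z := by
  rw [hg.analytic.lineDeriv_eq_add_jac] at hα
  rw [gaugeField, ← hα, add_sub_cancel_left, hg.inverse_jac]

theorem finAnalyticAt_gaugeField (hg : RegularAt g z) (hA : FinAnalyticAt A (gaugeMap g z))
    (hc : FinAnalyticFieldAt c z) : FinAnalyticAt (gaugeField c g A) z := by
  obtain ⟨e, he⟩ := hg.invertible
  have h1 : AnalyticAt ℂ ContinuousLinearMap.inverse (jac g z) := by
    rw [← he]
    exact (contDiffAt_map_inverse (n := ⊤) e).analyticAt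
  have h2 : FinAnalyticAt (fun z => (jac g z).inverse) z :=
    FinAnalyticAt.analytic_comp h1 hg.analytic.jac
  exact h2.clm_apply ((hA.map_comp (finAnalyticMapAt_gaugeMap hg.analytic)).sub
    (hg.analytic.lineDeriv_field hc))

theorem comp (hg : RegularAt g (gaugeMap h z)) (hh : RegularAt h z) :
    RegularAt (fun z => g (gaugeMap h z)) z := by
  have hF := hg.analytic.map_comp (finAnalyticMapAt_gaugeMap hh.analytic)
  refine ⟨hF, ?_⟩
  have : jac (fun z => g (gaugeMap h z)) z = (jac g (gaugeMap h z)).comp (jac h z) := by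
    ext1 v
    rw [hF.jac_apply, hg.analytic.lineDeriv_map_comp (finAnalyticMapAt_gaugeMap hh.analytic),
      mapDeriv_gaugeMap, ContinuousLinearMap.comp_apply, hg.analytic.jac_apply,
      hh.analytic.jac_apply]
  rw [this]
  exact hg.invertible.comp hh.invertible

/-- By the intertwining characterization this is the chain rule. The outer map g acts on the
covering first. -/
theorem gaugeField_comp (hg : RegularAt g (gaugeMap h z)) (hh : RegularAt h z) :
    gaugeField c (fun z => g (gaugeMap h z)) A z = gaugeField c h (gaugeField c g A) z := by
  refine ((hg.comp hh).eq_gaugeField ?_).symm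
  rw [hg.analytic.lineDeriv_map_comp (finAnalyticMapAt_gaugeMap hh.analytic), mapDeriv_gaugeMap,
    hh.lineDeriv_gaugeField]
  exact hg.lineDeriv_gaugeField (z := gaugeMap h z)

/-- The derivative of the transformed field in the direction of `u^i_{k+1}`, for a gauge
transformation that does not depend on `u^i_{k+1}`. -/
theorem lineDeriv_gaugeField_unitU (hg : RegularAt g z) (hA : FinAnalyticAt A (gaugeMap g z))
    {i : Fin m} {k : ℕ} (hd : ∀ᶠ z' in 𝓝 z, lineDeriv ℂ g z' (unitU i (k + 1), 0) = 0) :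
    lineDeriv ℂ g z (unitU i k, 0) +
      jac g z (lineDeriv ℂ (gaugeField fieldX g A) z (unitU i (k + 1), 0)) =
    lineDeriv ℂ A (gaugeMap g z) (unitU i (k + 1), 0) := by
  have hG := finAnalyticMapAt_gaugeMap hg.analytic
  have hA' := hg.finAnalyticAt_gaugeField hA (finAnalyticFieldAt_X z)
  -- The commutator of ∂/∂u^i_{k+1} with D_x + Ã has horizontal part ∂/∂u^i_k and vertical part
  -- ∂Ã/∂u^i_{k+1}. Applied to g, it gives the derivative of A∘G, to which g contributes nothing
  -- since it is independent of u^i_{k+1}.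
  have hcomm := hg.analytic.lineDeriv_commutator (finAnalyticFieldAt_const (unitU i (k + 1)) z)
    ((finAnalyticFieldAt_X z).lift hA')
  rw [mapDeriv_const, mapDeriv_X, sub_zero] at hcomm
  have h1 : lineDeriv ℂ (fun z => lineDeriv ℂ g z (unitU i (k + 1), 0)) z
      (fieldX z.1, gaugeField fieldX g A z) = 0 := by
    rw [lineDeriv_congr (g := fun _ => 0) hd, lineDeriv_const']
  have h2 : (fun z => lineDeriv ℂ g z (fieldX z.1, gaugeField fieldX g A z)) =ᶠ[𝓝 z]
      fun z => A (gaugeMap g z) :=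
    hg.eventually.mono fun z' hz' => hz'.lineDeriv_gaugeField
  rw [h1, sub_zero, lineDeriv_congr h2, hA.lineDeriv_map_comp hG, mapDeriv_gaugeMap,
    hd.self_of_nhds] at hcomm
  rw [hcomm]
  conv_rhs => rw [hg.analytic.lineDeriv_eq_add_jac]
  congr 3
  refine Prod.ext rfl (Prod.ext rfl ?_)
  funext j l
  by_cases hj : j = i
  · subst hj
    by_cases hl : l = k
    · subst hl; simp [unitU]
    · simp [unitU, hl]
  · simp [unitU, hj]

end RegularAt

end Gauge
-- Gauge invariance of the zero-curvature equation
section Covering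

variable {m q d : ℕ} (S : EvolutionSystem m d)

/-- The bracket [A,B] supplies exactly the vertical parts of (D_x + A)B − (D_t + B)A. -/
theorem zeroCurvature_eq {A B : Tot m q → Fin q → ℂ} {z : Tot m q}
    (hA : FinAnalyticAt A z) (hB : FinAnalyticAt B z) :
    Dx (fun y => B (y, z.2)) z.1 - S.Dt (fun y => A (y, z.2)) z.1
      + VectorField.lieBracket ℂ (fun w => A (z.1, w)) (fun w => B (z.1, w)) z.2 =
    lineDeriv ℂ B z (fieldX z.1, A z) - lineDeriv ℂ A z (S.fieldT z.1, B z) := by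
  rw [hA.lineDeriv_eq_add_jac, hB.lineDeriv_eq_add_jac, Dx_eq_lineDeriv hB, Dt_eq_lineDeriv S hA]
  simp only [VectorField.lieBracket, jac]
  abel

/-- Gauge transformations preserve the zero-curvature equation. -/
theorem RegularAt.zeroCurvature {g A B : Tot m q → Fin q → ℂ} {z : Tot m q} (hg : RegularAt g z)
    (hA : FinAnalyticAt A (gaugeMap g z)) (hB : FinAnalyticAt B (gaugeMap g z))
    (hz : z.1 ∈ S.prolongation)
    (hAB : lineDeriv ℂ B (gaugeMap g z) (fieldX z.1, A (gaugeMap g z)) =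
      lineDeriv ℂ A (gaugeMap g z) (S.fieldT z.1, B (gaugeMap g z))) :
    lineDeriv ℂ (gaugeField S.fieldT g B) z (fieldX z.1, gaugeField fieldX g A z) =
      lineDeriv ℂ (gaugeField fieldX g A) z (S.fieldT z.1, gaugeField S.fieldT g B z) := by
  have hG := finAnalyticMapAt_gaugeMap hg.analytic
  have hA' := hg.finAnalyticAt_gaugeField hA (finAnalyticFieldAt_X z)
  have hB' := hg.finAnalyticAt_gaugeField hB (finAnalyticFieldAt_T S hz)
  -- Applied to g, the commutator of the transformed fields is the curvature of the original
  -- covering, hence 0. The commutator is vertical because D_x and D_t commute, and ∂g/∂w is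
  -- injective, so the commutator itself vanishes.
  have hcomm := hg.analytic.lineDeriv_commutator ((finAnalyticFieldAt_X z).lift hA')
    ((finAnalyticFieldAt_T S hz).lift hB')
  have h1 : (fun z => lineDeriv ℂ g z (fieldX z.1, gaugeField fieldX g A z)) =ᶠ[𝓝 z]
      fun z => A (gaugeMap g z) :=
    hg.eventually.mono fun z' hz' => hz'.lineDeriv_gaugeField
  have h2 : (fun z => lineDeriv ℂ g z (S.fieldT z.1, gaugeField S.fieldT g B z)) =ᶠ[𝓝 z]
      fun z => B (gaugeMap g z) :=
    hg.eventually.mono fun z' hz' => hz'.lineDeriv_gaugeField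
  rw [lineDeriv_congr h1, lineDeriv_congr h2, hA.lineDeriv_map_comp hG, hB.lineDeriv_map_comp hG,
    mapDeriv_gaugeMap, mapDeriv_gaugeMap, hg.lineDeriv_gaugeField, hg.lineDeriv_gaugeField, hAB,
    sub_self, mapDeriv_X, mapDeriv_T_X S hz] at hcomm
  rw [← sub_eq_zero]
  refine hg.jac_eq_zero ?_
  rw [hg.analytic.jac_apply, hcomm]
  congr 1
  simp [EvolutionSystem.fieldT]

end Covering

/-! ### Independence of selected coordinates -/

section Masks

variable {m q : ℕ} {V : Type*} [NormedAddCommGroup V] [NormedSpace ℂ V]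

/-- Multiply the coordinates of a jet by given scalars. -/
def mask (cx ct : ℂ) (χ : Fin m → ℕ → ℂ) : Jet m →L[ℂ] Jet m where
  toFun y := (cx * y.1, ct * y.2.1, fun i k => χ i k * y.2.2 i k)
  map_add' y y' := by simp [Prod.ext_iff, funext_iff, mul_add]
  map_smul' s y := by simp [Prod.ext_iff, funext_iff, mul_left_comm]
  cont := by fun_prop

theorem mask_apply (cx ct : ℂ) (χ : Fin m → ℕ → ℂ) (y : Jet m) :
    mask cx ct χ y = (cx * y.1, ct * y.2.1, fun i k => χ i k * y.2.2 i k) := rfl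

theorem FinAnalyticAt.lineDeriv_horizontal {f : Tot m q → V} {z : Tot m q}
    (hf : FinAnalyticAt f z) (η : Jet m) :
    lineDeriv ℂ f z (η, 0) = η.1 • lineDeriv ℂ f z ((1, 0, 0), 0) +
      η.2.1 • lineDeriv ℂ f z ((0, 1, 0), 0) +
      ∑ᶠ ik : Fin m × ℕ, η.2.2 ik.1 ik.2 • lineDeriv ℂ f z (unitU ik.1 ik.2, 0) := by
  rw [hf.finsum_lineDeriv_unitU]
  obtain ⟨L, hL⟩ := hf.exists_deriv
  simp only [(hL _).lineDeriv, ← map_smul, ← map_add]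
  congr 1
  simp

/-- Finite order reduces a direction mixing infinitely many coordinates to the individual partial
derivatives. -/
theorem FinAnalyticAt.lineDeriv_mask_eq_zero {f : Tot m q → V} {z : Tot m q}
    (hf : FinAnalyticAt f z) {cx ct : ℂ} {χ : Fin m → ℕ → ℂ}
    (hx : cx ≠ 0 → lineDeriv ℂ f z ((1, 0, 0), 0) = 0)
    (ht : ct ≠ 0 → lineDeriv ℂ f z ((0, 1, 0), 0) = 0)
    (hu : ∀ i k, χ i k ≠ 0 → lineDeriv ℂ f z (unitU i k, 0) = 0) (η : Jet m) :
    lineDeriv ℂ f z (mask cx ct χ η, 0) = 0 := by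
  have key : ∀ (c s : ℂ) (v : V), (c ≠ 0 → v = 0) → (c * s) • v = 0 := by
    intro c s v h
    by_cases hc : c = 0
    · simp [hc]
    · simp [h hc]
  rw [hf.lineDeriv_horizontal]
  simp only [mask_apply]
  rw [key _ _ _ hx, key _ _ _ ht, finsum_eq_zero_of_forall_eq_zero]
  · simp
  · exact fun ik => key _ _ _ (hu ik.1 ik.2)

/-- A function whose derivatives in the directions in the range of `R` vanish near `(a, b)` does not
depend on these directions. -/
theorem FinAnalyticAt.eventually_eq_of_lineDeriv_eq_zero [CompleteSpace V] {f : Tot m q → V}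
    {a : Jet m} {b : Fin q → ℂ} (hf : FinAnalyticAt f (a, b)) (R : Jet m →L[ℂ] Jet m)
    (h0 : ∀ᶠ z in 𝓝 (a, b), ∀ η, lineDeriv ℂ f z (R η, 0) = 0) :
    ∀ᶠ z in 𝓝 (a, b), f z = f (z.1 - R (z.1 - a), z.2) := by
  -- The segment along which z is moved shrinks to (a, b) when z = (a, b). Compactness of [0,1] then
  -- gives one neighborhood of (a, b) whose segments stay where the hypotheses hold.
  have hev : ∀ s ∈ Set.Icc (0 : ℝ) 1, ∀ᶠ p : Tot m q × ℝ in 𝓝 ((a, b), s),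
      FinAnalyticAt f (p.1.1 - (p.2 : ℂ) • R (p.1.1 - a), p.1.2) ∧
      ∀ η, lineDeriv ℂ f (p.1.1 - (p.2 : ℂ) • R (p.1.1 - a), p.1.2) (R η, 0) = 0 := by
    intro s _
    have hc : Continuous (fun p : Tot m q × ℝ =>
        ((p.1.1 - (p.2 : ℂ) • R (p.1.1 - a), p.1.2) : Tot m q)) := by
      have := R.continuous
      fun_prop
    have h := hc.tendsto ((a, b), s)
    simp only [sub_self, map_zero, smul_zero, sub_zero] at h
    exact h.eventually (hf.eventually.and h0)
  have hev' := isCompact_Icc.eventually_forall_of_forall_eventually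
    (P := fun (z : Tot m q) (s : ℝ) => FinAnalyticAt f (z.1 - (s : ℂ) • R (z.1 - a), z.2) ∧
      ∀ η, lineDeriv ℂ f (z.1 - (s : ℂ) • R (z.1 - a), z.2) (R η, 0) = 0) hev
  filter_upwards [hev'] with z hz
  set v : Tot m q := (R (z.1 - a), 0) with hv
  have hd : ∀ s ∈ Set.Icc (0 : ℝ) 1, HasDerivAt (fun s : ℝ => f (z - (s : ℂ) • v)) 0 s := by
    intro s hs
    have hpt : ((z.1 - (s : ℂ) • R (z.1 - a), z.2) : Tot m q) = z - (s : ℂ) • v := by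
      simp [hv, Prod.ext_iff]
    have h1 := (hz s hs).1.hasLineDerivAt v
    rw [(hz s hs).2, hpt] at h1
    have h2 : HasDerivAt (fun s' : ℝ => ((s - s' : ℝ) : ℂ)) (-1) s := by
      have := ((hasDerivAt_id s).const_sub s).ofReal_comp
      simpa using this
    have h1' : HasDerivAt (fun t : ℂ => f (z - (s : ℂ) • v + t • v)) 0 ((s - s : ℝ) : ℂ) := by
      simpa [HasLineDerivAt] using h1
    have h3 := h1'.scomp s h2
    rw [smul_zero] at h3
    refine h3.congr_of_eventuallyEq (Eventually.of_forall fun s' => ?_)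
    simp only [Function.comp]
    congr 1
    push_cast
    module
  have := constant_of_has_deriv_right_zero
    (fun s hs => (hd s hs).continuousAt.continuousWithinAt)
    (fun s hs => (hd s (Set.Ico_subset_Icc_self hs)).hasDerivWithinAt) 1 (by simp)
  simp only [Complex.ofReal_one, one_smul, Complex.ofReal_zero, zero_smul, sub_zero] at this
  rw [← this]
  congr 1
  simp [hv, Prod.ext_iff]

end Masks
-- Gauge transformations from differential equations
section FlowGauge

variable {m q : ℕ} {a : Jet m} {b : Fin q → ℂ}

/-- The gauge transformation obtained by solving an ordinary differential equation in the coordinate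
`l`, with the coordinates selected by the mask as parameters. -/
theorem FinAnalyticAt.exists_flow {f : Tot m q → Fin q → ℂ} (hf : FinAnalyticAt f (a, b))
    (l : Jet m →L[ℂ] ℂ) (hl : FinAnalyticAt (fun z : Tot m q => l z.1) (a, b)) (v : Jet m)
    (cx ct : ℂ) (χ : Fin m → ℕ → ℂ) :
    ∃ h : Tot m q → Fin q → ℂ, FinAnalyticAt h (a, b) ∧
      (∀ᶠ z in 𝓝 (a, b), l (z.1 - a) = 0 → h z = z.2) ∧
      ∀ᶠ z in 𝓝 (a, b), ∀ η, mask cx ct χ η = 0 → lineDeriv ℂ h z (η, 0) =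
        l η • f (a + l (z.1 - a) • v + mask cx ct χ (z.1 - a), h z) := by
  obtain ⟨n, φ, hφ, hfφ⟩ := hf
  set Q := mask cx ct χ with hQ
  let J : Jet m →L[ℂ] FinJet m n := (ContinuousLinearMap.fst ℂ _ _).comp
    ((proj n).comp (ContinuousLinearMap.inl ℂ (Jet m) (Fin q → ℂ)))
  have hJ : ∀ y, J y = trunc n y := fun _ => rfl
  -- Coordinates that are neither the time variable nor selected by the mask are frozen at a.
  -- Parameters are truncated so that they range over a Banach space.
  let F : (Fin q → ℂ) × ℂ × FinJet m n → Fin q → ℂ := fun v' =>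
    φ (J a + v'.2.1 • J v + v'.2.2, v'.1)
  have hF : AnalyticAt ℂ F (b, 0, 0) := by
    refine AnalyticAt.fun_comp (g := φ) (f := fun v' : (Fin q → ℂ) × ℂ × FinJet m n =>
      (J a + v'.2.1 • J v + v'.2.2, v'.1)) ?_ ?_
    · simpa [hJ, proj_apply] using hφ
    · have h1 : AnalyticAt ℂ (fun v' : (Fin q → ℂ) × ℂ × FinJet m n => v'.2.1) (b, 0, 0) :=
        analyticAt_fst.fun_comp analyticAt_snd
      have h2 : AnalyticAt ℂ (fun v' : (Fin q → ℂ) × ℂ × FinJet m n => v'.2.2) (b, 0, 0) :=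
        analyticAt_snd.fun_comp analyticAt_snd
      exact ((analyticAt_const.add (h1.smul analyticAt_const)).add h2).prod analyticAt_fst
  obtain ⟨Γ, hΓ, hΓ0, hΓi, hΓd⟩ := hF.exists_flow
  set P : Tot m q → (Fin q → ℂ) × ℂ × FinJet m n := fun z =>
    (z.2, l (z.1 - a), J (Q (z.1 - a))) with hP
  have hP0 : P (a, b) = (b, 0, 0) := by simp [hP]
  have hPa : FinAnalyticAt P (a, b) := by
    have hQa : FinAnalyticMapAt (fun z : Tot m q => (Q (z.1 - a), (0 : Fin q → ℂ))) (a, b) := by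
      have hsub : ∀ {c e : ℂ} {p : Tot m q → ℂ}, FinAnalyticAt p (a, b) →
          FinAnalyticAt (fun z => c * (p z - e)) (a, b) := fun {c e p} hp =>
        FinAnalyticAt.analytic_comp (Φ := fun s : ℂ => c * (s - e))
          (analyticAt_const.mul (analyticAt_id.sub analyticAt_const)) hp
      exact ⟨hsub (finAnalyticAt_fst_x _), hsub (finAnalyticAt_fst_t _),
        fun i k => hsub (finAnalyticAt_fst_u i k _), .const _⟩
    have h1 : FinAnalyticAt (fun z : Tot m q => l (z.1 - a)) (a, b) := by
      simpa only [map_sub] using hl.sub (.const (l a))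
    exact (finAnalyticAt_snd _).prodMk (h1.prodMk
      (FinAnalyticAt.analytic_comp (f := fun z : Tot m q => proj n (Q (z.1 - a), (0 : Fin q → ℂ)))
        (Φ := Prod.fst) analyticAt_fst (hQa.proj_comp n)))
  have hPt : Tendsto P (𝓝 (a, b)) (𝓝 (b, 0, 0)) := hP0 ▸ hPa.continuousAt
  have hh : FinAnalyticAt (fun z => Γ (P z)) (a, b) :=
    FinAnalyticAt.analytic_comp (hP0.symm ▸ hΓ) hPa
  refine ⟨fun z => Γ (P z), hh, ?_, ?_⟩
  · filter_upwards [hPt.eventually hΓi] with z hz h0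
    exact hz h0
  · have hc : Tendsto (fun z : Tot m q => ((a + l (z.1 - a) • v + Q (z.1 - a), Γ (P z)) : Tot m q))
        (𝓝 (a, b)) (𝓝 (a, b)) := by
      have h1 : ContinuousAt (fun z : Tot m q => a + l (z.1 - a) • v + Q (z.1 - a)) (a, b) := by
        have := Q.continuous
        have := l.continuous
        fun_prop
      have h2 := h1.prodMk hh.continuousAt
      simp only [ContinuousAt, sub_self, map_zero, zero_smul, add_zero, hP0, hΓ0] at h2
      exact h2
    filter_upwards [hPt.eventually hΓd, hc.eventually hfφ] with z hz hz' η hη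
    rw [hz']
    have h1 : HasDerivAt (fun s => Γ ((P z).1, s, (P z).2.2)) (F (Γ (P z), (P z).2))
        (l (z.1 - a) + 0 * l η) := by simpa [hP] using hz
    -- A direction in the kernel of the mask leaves the parameters fixed and moves only the time, at
    -- speed `l η`.
    have h2 : HasDerivAt (fun t : ℂ => l (z.1 - a) + t * l η) (l η) 0 := by
      simpa using ((hasDerivAt_id (0 : ℂ)).mul_const (l η)).const_add (l (z.1 - a))
    have h3 := h1.scomp (0 : ℂ) h2
    have h4 : HasLineDerivAt ℂ (fun z => Γ (P z)) (l η • F (Γ (P z), (P z).2)) z (η, 0) := by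
      refine h3.congr_of_eventuallyEq (Eventually.of_forall fun t => ?_)
      simp only [Function.comp, hP, Prod.fst_add, Prod.snd_add, Prod.smul_fst, Prod.smul_snd,
        smul_zero, add_zero, add_sub_right_comm, map_add, map_smul, hη, smul_eq_mul]
    rw [h4.lineDeriv]
    simp only [F, hP, Function.comp, proj_apply, ← hJ, map_add, map_smul]

end FlowGauge

/-! ### Local inverses of gauge transformations -/

section Inverse

variable {m q : ℕ} {a : Jet m} {b : Fin q → ℂ}

/-- The inverse of a gauge transformation, as a germ. -/
theorem RegularAt.exists_inverse {g : Tot m q → Fin q → ℂ} (hg : RegularAt g (a, b))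
    (hgab : g (a, b) = b) :
    ∃ h : Tot m q → Fin q → ℂ, FinAnalyticAt h (a, b) ∧ h (a, b) = b ∧
      (∀ᶠ z in 𝓝 (a, b), h (gaugeMap g z) = z.2) ∧
      ∀ᶠ z in 𝓝 (a, b), g (gaugeMap h z) = z.2 := by
  obtain ⟨⟨n, φ, hφ, hgφ⟩, e, he⟩ := hg
  rw [jac, (hasFDerivAt_snd_of_factor hφ.differentiableAt hgφ).fderiv] at he
  set M := fderiv ℂ φ (proj n (a, b)) with hM
  set Θ : FinJet m n × (Fin q → ℂ) → FinJet m n × (Fin q → ℂ) := fun v => (v.1, φ v) with hΘ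
  have hΘa : AnalyticAt ℂ Θ (proj n (a, b)) := analyticAt_fst.prod hφ
  have hφab : φ (proj n (a, b)) = b := hgφ.self_of_nhds.symm.trans hgab
  have hΘ0 : Θ (proj n (a, b)) = proj n (a, b) := by
    simp only [hΘ, hφab]; rfl
  let L := M.comp (ContinuousLinearMap.inl ℂ (FinJet m n) (Fin q → ℂ))
  have hval : ∀ v, M v = L v.1 + e v.2 := by
    intro v
    have h1 : e v.2 = M (0, v.2) := congrArg (fun T : (Fin q → ℂ) →L[ℂ] (Fin q → ℂ) => T v.2) he
    rw [h1]
    simp only [L, ContinuousLinearMap.comp_apply, ContinuousLinearMap.inl_apply]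
    rw [← map_add]
    simp
  let E : (FinJet m n × (Fin q → ℂ)) ≃L[ℂ] (FinJet m n × (Fin q → ℂ)) :=
    ContinuousLinearEquiv.equivOfInverse
      ((ContinuousLinearMap.fst ℂ _ _).prod M)
      ((ContinuousLinearMap.fst ℂ _ _).prod ((e.symm : (Fin q → ℂ) →L[ℂ] (Fin q → ℂ)).comp
        (.snd ℂ _ _ - L.comp (.fst ℂ _ _))))
      (fun v => by simp [hval]) (fun v => by simp [hval])
  have hE : fderiv ℂ Θ (proj n (a, b)) = E :=
    (hasFDerivAt_fst.prodMk hφ.differentiableAt.hasFDerivAt).fderiv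
  obtain ⟨G, hG, hG0, hl, hr⟩ := hΘa.exists_local_inverse E hE
  rw [hΘ0] at hG hG0 hr
  have hc : Tendsto (proj (m := m) (q := q) n) (𝓝 (a, b)) (𝓝 (proj n (a, b))) :=
    (proj n).continuous.tendsto _
  have hH : FinAnalyticAt (fun z => (G (proj n z)).2) (a, b) :=
    FinAnalyticAt.of_factor (φ := fun v => (G v).2) (analyticAt_snd.fun_comp hG)
  have hHab : (G (proj n (a, b))).2 = b := by rw [hG0]; rfl
  refine ⟨fun z => (G (proj n z)).2, hH, hHab, ?_, ?_⟩
  · filter_upwards [hgφ, hc.eventually hl] with z hz1 hz2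
    have : proj n (gaugeMap g z) = Θ (proj n z) := by
      simp only [gaugeMap, hz1]; rfl
    rw [this, hz2]
    rfl
  · have hHt : Tendsto (gaugeMap fun z => (G (proj n z)).2) (𝓝 (a, b)) (𝓝 (a, b)) := by
      have := (finAnalyticMapAt_gaugeMap hH).continuousAt.tendsto
      simpa only [gaugeMap, hHab] using this
    filter_upwards [hHt.eventually hgφ, hc.eventually hr] with z hz1 hz2
    obtain ⟨h1, h2⟩ := Prod.ext_iff.1 hz2
    change (G (proj n z)).1 = (proj n z).1 at h1
    change φ (G (proj n z)) = z.2 at h2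
    rw [hz1, ← h2]
    simp only [Function.comp]
    congr 1
    exact Prod.ext h1.symm rfl

end Inverse

/-! ### Passing between germs and functions on open sets -/

section Neighborhoods

variable {m q : ℕ}

theorem FinAnalyticOn.finAnalyticAt {f : Tot m q → Fin q → ℂ} {Ω : Set (Tot m q)}
    (hf : FinAnalyticOn f Ω) (hΩ : IsOpen Ω) {z : Tot m q} (hz : z ∈ Ω) : FinAnalyticAt f z := by
  obtain ⟨n, φ, hφ⟩ := hf
  exact ⟨n, φ, (hφ z hz).1, (hΩ.mem_nhds hz |> mem_of_superset) fun z' hz' => (hφ z' hz').2⟩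

theorem FinAnalyticOn.mono {f : Tot m q → Fin q → ℂ} {Ω Ω' : Set (Tot m q)}
    (hf : FinAnalyticOn f Ω) (h : Ω' ⊆ Ω) : FinAnalyticOn f Ω' := by
  obtain ⟨n, φ, hφ⟩ := hf
  exact ⟨n, φ, fun z hz => hφ z (h hz)⟩

theorem FinAnalyticAt.exists_mem_nhds {f : Tot m q → Fin q → ℂ} {z : Tot m q}
    (hf : FinAnalyticAt f z) : ∃ U ∈ 𝓝 z, FinAnalyticOn f U := by
  obtain ⟨n, φ, hφ, hfφ⟩ := hf
  exact ⟨_, inter_mem ((proj n).continuous.continuousAt.eventually hφ.eventually_analyticAt) hfφ,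
    n, φ, fun z hz => hz⟩

theorem exists_convex_open_subset {U : Set (Tot m q)} {z : Tot m q} (hU : U ∈ 𝓝 z) :
    ∃ N ⊆ U, IsOpen N ∧ Convex ℝ N ∧ z ∈ N := by
  obtain ⟨K, ⟨hK, hKc⟩, hKU⟩ := (LocallyConvexSpace.convex_basis (𝕜 := ℝ) z).mem_iff.1 hU
  exact ⟨interior K, interior_subset.trans hKU, isOpen_interior, hKc.interior,
    mem_interior_iff_mem_nhds.2 hK⟩

/-- The identity theorem on convex open sets. -/
theorem eqOn_of_convex {f g : Tot m q → Fin q → ℂ} {N : Set (Tot m q)}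
    (hNc : Convex ℝ N) {z₀ : Tot m q} (hz₀ : z₀ ∈ N) (hf : ∀ z ∈ N, FinAnalyticAt f z)
    (hg : ∀ z ∈ N, FinAnalyticAt g z) (hfg : f =ᶠ[𝓝 z₀] g) : Set.EqOn f g N := by
  intro z hz
  have hc : Continuous fun s : ℂ => z₀ + s • (z - z₀) := by fun_prop
  -- Restriction to the complex line through z₀ and z reduces the claim to one variable; convexity
  -- of N makes its trace on the line connected.
  set T : Set ℂ := (fun s : ℂ => z₀ + s • (z - z₀)) ⁻¹' N with hT
  have hTc : Convex ℝ T := by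
    intro s hs t ht α β hα hβ hαβ
    have := hNc hs ht hα hβ hαβ
    simp only [hT, Set.mem_preimage] at this ⊢
    convert this using 1
    generalize z - z₀ = v
    have hz0 : z₀ = α • z₀ + β • z₀ := by rw [← add_smul, hαβ, one_smul]
    conv_lhs => rw [hz0]
    simp only [smul_add, add_smul, smul_assoc]
    abel
  have key : ∀ F : Tot m q → Fin q → ℂ, (∀ z ∈ N, FinAnalyticAt F z) →
      AnalyticOnNhd ℂ (fun s : ℂ => F (z₀ + s • (z - z₀))) T := by
    intro F hF s hs
    obtain ⟨n, φ, hφ, hFφ⟩ := hF _ hs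
    have h1 : AnalyticAt ℂ (fun s : ℂ => proj n z₀ + s • proj n (z - z₀)) s :=
      analyticAt_const.add (analyticAt_id.smul analyticAt_const)
    have h2 : AnalyticAt ℂ (fun s : ℂ => φ (proj n z₀ + s • proj n (z - z₀))) s := by
      refine AnalyticAt.fun_comp (f := fun s : ℂ => proj n z₀ + s • proj n (z - z₀)) ?_ h1
      simpa only [map_add, map_smul] using hφ
    refine h2.congr ?_
    filter_upwards [hc.continuousAt.eventually hFφ] with s' hs'
    rw [hs']
    simp only [Function.comp, map_add, map_smul]
  have h0 : (0 : ℂ) ∈ T := by simpa [hT] using hz₀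
  have hev : (fun s : ℂ => f (z₀ + s • (z - z₀))) =ᶠ[𝓝 0] fun s : ℂ => g (z₀ + s • (z - z₀)) := by
    have := hc.tendsto 0
    rw [zero_smul, add_zero] at this
    exact this.eventually hfg
  have := (key f hf).eqOn_of_preconnected_of_eventuallyEq (key g hg) hTc.isPreconnected h0 hev
    (show (1 : ℂ) ∈ T by simpa [hT] using hz)
  simpa using this

end Neighborhoods

/-! ### Gauge germs that are the identity over a, and the ordering of indices -/

section Germs

variable {m q : ℕ} {a : Jet m} {b : Fin q → ℂ}

/-- Germs at `(a, b)` of gauge transformations that are the identity over `a`. -/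
structure IsGaugeGerm (a : Jet m) (b : Fin q → ℂ) (g : Tot m q → Fin q → ℂ) : Prop where
  analytic : FinAnalyticAt g (a, b)
  identity : ∀ᶠ w in 𝓝 b, g (a, w) = w

namespace IsGaugeGerm

variable {g h A A' : Tot m q → Fin q → ℂ} {c : Jet m → Jet m}

theorem apply_self (hg : IsGaugeGerm a b g) : g (a, b) = b := hg.identity.self_of_nhds

/-- Over a the map is the identity in w, so its Jacobian at (a, b) is the identity. -/
theorem regularAt (hg : IsGaugeGerm a b g) : RegularAt g (a, b) := by
  refine ⟨hg.analytic, ContinuousLinearEquiv.refl ℂ _, ?_⟩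
  have h : (fun w => g (a, w)) =ᶠ[𝓝 b] id := hg.identity
  simp only [jac]
  rw [h.fderiv_eq, fderiv_id]
  rfl

theorem gaugeMap_self (hg : IsGaugeGerm a b g) : gaugeMap g (a, b) = (a, b) := by
  simp only [gaugeMap, hg.apply_self]

theorem tendsto (hg : IsGaugeGerm a b g) : Tendsto (gaugeMap g) (𝓝 (a, b)) (𝓝 (a, b)) := by
  have := (finAnalyticMapAt_gaugeMap hg.analytic).continuousAt.tendsto
  rwa [hg.gaugeMap_self] at this

theorem of_eq_snd (hg : FinAnalyticAt g (a, b)) {P : Jet m → Prop} (hP : P a)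
    (h : ∀ᶠ z in 𝓝 (a, b), P z.1 → g z = z.2) : IsGaugeGerm a b g := by
  have hc : Tendsto (fun w => (a, w)) (𝓝 b) (𝓝 (a, b)) :=
    Continuous.tendsto (by fun_prop : Continuous fun w => (a, w)) b
  exact ⟨hg, (hc.eventually h).mono fun w hw => hw hP⟩

theorem snd : IsGaugeGerm a b (fun z : Tot m q => z.2) :=
  ⟨finAnalyticAt_snd _, Eventually.of_forall fun _ => rfl⟩

theorem comp (hg : IsGaugeGerm a b g) (hh : IsGaugeGerm a b h) :
    IsGaugeGerm a b (fun z => g (gaugeMap h z)) := by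
  refine ⟨FinAnalyticAt.map_comp (X := gaugeMap h) ?_ (finAnalyticMapAt_gaugeMap hh.analytic), ?_⟩
  · rw [hh.gaugeMap_self]; exact hg.analytic
  · filter_upwards [hg.identity, hh.identity] with w h1 h2
    simp only [gaugeMap, h2, h1]

theorem gaugeField_comp (hg : IsGaugeGerm a b g) (hh : IsGaugeGerm a b h) :
    gaugeField c (fun z => g (gaugeMap h z)) A =ᶠ[𝓝 (a, b)]
      gaugeField c h (gaugeField c g A) := by
  filter_upwards [hh.tendsto.eventually hg.regularAt.eventually, hh.regularAt.eventually]
    with z h1 h2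
  exact h1.gaugeField_comp h2

theorem gaugeField_snd : gaugeField c (fun z : Tot m q => z.2) A = A := by
  funext z
  have hr : RegularAt (fun z : Tot m q => z.2) z := by
    refine ⟨finAnalyticAt_snd z, ContinuousLinearEquiv.refl ℂ _, ?_⟩
    simp only [jac]
    exact (fderiv_fun_id).symm
  refine (hr.eq_gaugeField ?_).symm
  have h : HasDerivAt (fun s : ℂ => z.2 + s • A z) (A z) 0 := by
    simpa using ((hasDerivAt_id (0 : ℂ)).smul_const (A z)).const_add z.2
  exact HasLineDerivAt.lineDeriv (f := fun z : Tot m q => z.2) h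

theorem finAnalyticAt_gaugeField (hg : IsGaugeGerm a b g) (hA : FinAnalyticAt A (a, b))
    (hc : FinAnalyticFieldAt c (a, b)) : FinAnalyticAt (gaugeField c g A) (a, b) :=
  hg.regularAt.finAnalyticAt_gaugeField (by rwa [hg.gaugeMap_self]) hc

end IsGaugeGerm

/-- The position of `(i, k)` in the ordering of the indices. -/
def rank (i : Fin m) (k : ℕ) : ℕ := k * m + i

theorem rank_inj {i i' : Fin m} {k k' : ℕ} (h : rank i k = rank i' k') : i = i' ∧ k = k' := by
  have hm : 0 < m := i.pos
  have hk : ∀ (i : Fin m) (k : ℕ), rank i k / m = k := fun i k => by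
    rw [rank, Nat.add_comm, Nat.add_mul_div_right _ _ hm, Nat.div_eq_of_lt i.2, zero_add]
  have h1 : k = k' := by rw [← hk i k, h, hk]
  subst h1
  refine ⟨Fin.ext ?_, rfl⟩
  simpa [rank] using h

theorem prec_iff_rank_lt {i i' : Fin m} {k k' : ℕ} : Prec i k i' k' ↔ rank i k < rank i' k' := by
  have h1 : k < k' → rank i k < rank i' k' := fun h => by
    have : (k + 1) * m ≤ k' * m := Nat.mul_le_mul_right m h
    have := i.2
    simp only [rank]
    nlinarith
  have h2 : k' < k → rank i' k' < rank i k := fun h => by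
    have : (k' + 1) * m ≤ k * m := Nat.mul_le_mul_right m h
    have := i'.2
    simp only [rank]
    nlinarith
  constructor
  · rintro (h | ⟨rfl, h⟩)
    · exact h1 h
    · simpa [rank] using h
  · intro h
    rcases lt_trichotomy k k' with hk | hk | hk
    · exact Or.inl hk
    · subst hk
      exact Or.inr ⟨rfl, by simpa [rank] using h⟩
    · exact absurd h (h2 hk).not_gt

theorem rank_lt_rank_succ (i : Fin m) (k : ℕ) : rank i k < rank i (k + 1) :=
  prec_iff_rank_lt.1 (Or.inl k.lt_succ_self)

theorem exists_rank_eq {r p : ℕ} (h : r < p * m) : ∃ (i : Fin m) (k : ℕ), rank i k = r ∧ k < p := by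
  have hm : 0 < m := Nat.pos_of_ne_zero fun h0 => by simp [h0] at h
  exact ⟨⟨r % m, Nat.mod_lt _ hm⟩, r / m, by simp [rank, Nat.div_add_mod'],
    (Nat.div_lt_iff_lt_mul hm).2 h⟩

theorem le_of_mul_le_rank {p k : ℕ} {i : Fin m} (h : p * m ≤ rank i k) : p ≤ k := by
  by_contra hk
  have : (k + 1) * m ≤ p * m := Nat.mul_le_mul_right m (by omega)
  have := i.2
  simp only [rank] at h
  nlinarith

/-- The normalization conditions on the derivatives of `A`, for the indices from `r` on. -/
def VanishFrom (a : Jet m) (b : Fin q → ℂ) (A : Tot m q → Fin q → ℂ) (r : ℕ) : Prop :=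
  ∀ᶠ z in 𝓝 (a, b), ∀ (i : Fin m) (k : ℕ), r ≤ rank i k →
    (∀ i' k', Prec i k i' k' → z.1.2.2 i' k' = a.2.2 i' k') →
      lineDeriv ℂ A z (unitU i (k + 1), 0) = 0

theorem VanishFrom.congr {A A' : Tot m q → Fin q → ℂ} {r : ℕ} (hA : VanishFrom a b A r)
    (h : A =ᶠ[𝓝 (a, b)] A') : VanishFrom a b A' r := by
  filter_upwards [hA, h.eventually_nhds] with z h1 h2 i k hr hl
  rw [← lineDeriv_congr h2]
  exact h1 i k hr hl

/-- The index (i, k+1) always comes after (i, k), so h is independent of that coordinate and the key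
identity applies. The differential equation `h2` cancels its other two terms, and the Jacobian is
invertible. -/
theorem IsGaugeGerm.vanishFrom {h A : Tot m q → Fin q → ℂ} {r : ℕ} (hh : IsGaugeGerm a b h)
    (hA : FinAnalyticAt A (a, b))
    (h1 : ∀ᶠ z in 𝓝 (a, b), ∀ (i : Fin m) (k : ℕ), r < rank i k →
      lineDeriv ℂ h z (unitU i k, 0) = 0)
    (h2 : ∀ᶠ z in 𝓝 (a, b), ∀ (i : Fin m) (k : ℕ), r ≤ rank i k →
      (∀ i' k', Prec i k i' k' → z.1.2.2 i' k' = a.2.2 i' k') →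
      lineDeriv ℂ h z (unitU i k, 0) = lineDeriv ℂ A (gaugeMap h z) (unitU i (k + 1), 0)) :
    VanishFrom a b (gaugeField fieldX h A) r := by
  filter_upwards [h1.eventually_nhds, h2, hh.regularAt.eventually,
    hh.tendsto.eventually hA.eventually] with z hz1 hz2 hz3 hz4 i k hr hl
  have key := hz3.lineDeriv_gaugeField_unitU hz4
    (hz1.mono fun z' hz' => hz' i (k + 1) (hr.trans_lt (rank_lt_rank_succ i k)))
  rw [hz2 i k hr hl, add_eq_left] at key
  exact hz3.jac_eq_zero key

end Germs

/-! ### Existence: the normalizing gauges, one coordinate at a time -/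

section Existence

variable {m q : ℕ} {a : Jet m} {b : Fin q → ℂ} {A B : Tot m q → Fin q → ℂ}

/-- The gauge transformation that achieves the normalization condition for one more index. -/
theorem exists_gauge_u (hA : FinAnalyticAt A (a, b)) (i₀ : Fin m) (k₀ : ℕ)
    (hV : VanishFrom a b A (rank i₀ k₀ + 1)) :
    ∃ h, IsGaugeGerm a b h ∧ VanishFrom a b (gaugeField fieldX h A) (rank i₀ k₀) ∧
      ∀ᶠ z in 𝓝 (a, b), ∀ (i : Fin m) (k : ℕ), rank i₀ k₀ < rank i k →
        lineDeriv ℂ h z (unitU i k, 0) = 0 := by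
  classical
  let l : Jet m →L[ℂ] ℂ :=
    { toFun := fun y => y.2.2 i₀ k₀
      map_add' := fun _ _ => rfl
      map_smul' := fun _ _ => rfl
      cont := by fun_prop }
  have hl : ∀ y, l y = y.2.2 i₀ k₀ := fun _ => rfl
  -- The parameters are x, t and the earlier coordinates; the later ones are frozen at a.
  let χ : Fin m → ℕ → ℂ := fun i k => if Prec i k i₀ k₀ then 1 else 0
  obtain ⟨h, hh, hid, hd⟩ := FinAnalyticAt.exists_flow
    (hA.lineDeriv_field (finAnalyticFieldAt_const (unitU i₀ (k₀ + 1)) (a, b)))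
    l (finAnalyticAt_fst_u i₀ k₀ _) (unitU i₀ k₀) 1 1 χ
  have hmask : ∀ i k, rank i₀ k₀ ≤ rank i k → mask 1 1 χ (unitU i k) = 0 := by
    intro i k hik
    refine Prod.ext (by simp [mask_apply, unitU]) (Prod.ext (by simp [mask_apply, unitU]) ?_)
    funext j n
    simp only [mask_apply, unitU, χ, prec_iff_rank_lt]
    by_cases hj : j = i
    · subst hj
      by_cases hn : n = k
      · subst hn; simp [hik]
      · simp [hn]
    · simp [hj]
  have hgerm : IsGaugeGerm a b h :=
    .of_eq_snd hh (P := fun y => l (y - a) = 0) (by simp) hid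
  have hzero : ∀ᶠ z in 𝓝 (a, b), ∀ (i : Fin m) (k : ℕ), rank i₀ k₀ < rank i k →
      lineDeriv ℂ h z (unitU i k, 0) = 0 := by
    filter_upwards [hd] with z hz i k hik
    rw [hz _ (hmask i k hik.le), hl]
    have : (unitU i k).2.2 i₀ k₀ = 0 := by
      by_cases hi : i₀ = i
      · subst hi
        have hk : k₀ ≠ k := fun h => by subst h; exact lt_irrefl _ hik
        simp [unitU, hk]
      · simp [unitU, hi]
    rw [this, zero_smul]
  refine ⟨h, hgerm, hgerm.vanishFrom hA hzero ?_, hzero⟩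
  filter_upwards [hd, hzero, hgerm.tendsto.eventually hV] with z hz1 hz2 hz3 i k hik hloc
  rcases hik.eq_or_lt with heq | hlt
  · obtain ⟨rfl, rfl⟩ := rank_inj heq
    rw [hz1 _ (hmask _ _ le_rfl), hl]
    have h1 : (unitU i₀ k₀).2.2 i₀ k₀ = 1 := by simp [unitU]
    -- On the locus, the frozen coordinates already have their values at a, so the equation is
    -- evaluated at the true point.
    have h2 : a + l (z.1 - a) • unitU i₀ k₀ + mask 1 1 χ (z.1 - a) = z.1 := by
      refine Prod.ext (by simp [mask_apply, unitU]) (Prod.ext (by simp [mask_apply, unitU]) ?_)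
      funext j n
      simp only [mask_apply, unitU, χ, hl, prec_iff_rank_lt] at hloc ⊢
      rcases lt_trichotomy (rank j n) (rank i₀ k₀) with hlt | heq' | hgt
      · by_cases hj : j = i₀
        · subst hj
          have hn : n ≠ k₀ := fun h => by subst h; exact lt_irrefl _ hlt
          simp [hlt, hn]
        · simp [hlt, hj]
      · obtain ⟨rfl, rfl⟩ := rank_inj heq'
        simp
      · have h3 := hloc j n hgt
        by_cases hj : j = i₀
        · subst hj
          have hn : n ≠ k₀ := fun h => by subst h; exact lt_irrefl _ hgt
          simp [hn, h3]
        · simp [hj, h3]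
    rw [h1, h2, one_smul]
    rfl
  -- At later indices both sides vanish: h does not depend on these coordinates, and A is already
  -- normalized there.
  · rw [hz2 i k hlt, hz3 i k hlt hloc]

/-- Normalization of the derivatives of `A` with respect to the `u^i_k`. -/
theorem exists_gauge_vanishFrom (hA : FinAnalyticAt A (a, b)) {p : ℕ}
    (hp : ∀ᶠ z in 𝓝 (a, b), ∀ (i : Fin m) (k : ℕ), p < k → lineDeriv ℂ A z (unitU i k, 0) = 0) :
    ∃ g, IsGaugeGerm a b g ∧ VanishFrom a b (gaugeField fieldX g A) 0 ∧
      ∀ᶠ z in 𝓝 (a, b), ∀ (i : Fin m) (k : ℕ), p ≤ k → lineDeriv ℂ g z (unitU i k, 0) = 0 := by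
  suffices H : ∀ j r, r + j = p * m → ∃ g, IsGaugeGerm a b g ∧
      VanishFrom a b (gaugeField fieldX g A) r ∧
      ∀ᶠ z in 𝓝 (a, b), ∀ (i : Fin m) (k : ℕ), p ≤ k → lineDeriv ℂ g z (unitU i k, 0) = 0 from
    H (p * m) 0 (zero_add _)
  intro j
  induction j with
  | zero =>
    intro r hr
    -- Rank at least pm means k ≥ p, so ∂A/∂u^i_{k+1} vanishes by the order bound and the identity
    -- gauge suffices.
    refine ⟨fun z => z.2, .snd, ?_, Eventually.of_forall fun z i k _ => ?_⟩
    · rw [IsGaugeGerm.gaugeField_snd]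
      filter_upwards [hp] with z hz i k hik _
      exact hz i (k + 1) (Nat.lt_succ_of_le (le_of_mul_le_rank (by rw [← hr]; simpa using hik)))
    · simp [lineDeriv]
  | succ j ih =>
    intro r hr
    obtain ⟨g, hg, hgV, hgp⟩ := ih (r + 1) (by omega)
    obtain ⟨i₀, k₀, rfl, hk₀⟩ := exists_rank_eq (show r < p * m by omega)
    obtain ⟨h, hh, hhV, hhr⟩ :=
      exists_gauge_u (hg.finAnalyticAt_gaugeField hA (finAnalyticFieldAt_X _)) i₀ k₀ hgV
    refine ⟨_, hg.comp hh, hhV.congr (hg.gaugeField_comp hh).symm, ?_⟩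
    filter_upwards [hh.tendsto.eventually hgp, hhr, hh.analytic.eventually,
      hh.tendsto.eventually hg.analytic.eventually] with z h1 h2 h3 h4 i k hk
    rw [h4.lineDeriv_map_comp (finAnalyticMapAt_gaugeMap h3), mapDeriv_gaugeMap,
      h2 i k (prec_iff_rank_lt.1 (Or.inl (hk₀.trans_le hk)))]
    exact h1 i k hk

/-- Gauges independent of u preserve the derivative conditions, since they change no jet coordinate
and ∂h/∂u^i_k drops out of the key identity. -/
theorem IsGaugeGerm.vanishFrom_of_lineDeriv_eq_zero {h : Tot m q → Fin q → ℂ}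
    (hh : IsGaugeGerm a b h) (hA : FinAnalyticAt A (a, b))
    (hV : VanishFrom a b A 0)
    (h0 : ∀ᶠ z in 𝓝 (a, b), ∀ (i : Fin m) (k : ℕ), lineDeriv ℂ h z (unitU i k, 0) = 0) :
    VanishFrom a b (gaugeField fieldX h A) 0 := by
  refine hh.vanishFrom hA (h0.mono fun z hz i k _ => hz i k) ?_
  filter_upwards [h0, hh.tendsto.eventually hV] with z h1 h2 i k _ hloc
  rw [h1, h2 i k (Nat.zero_le _) hloc]

/-- Normalization of `A` along `u = a`. -/
theorem exists_gauge_x (hA : FinAnalyticAt A (a, b)) (hV : VanishFrom a b A 0) :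
    ∃ h, IsGaugeGerm a b h ∧ VanishFrom a b (gaugeField fieldX h A) 0 ∧
      (∀ᶠ z in 𝓝 (a, b), z.1.2.2 = a.2.2 → gaugeField fieldX h A z = 0) ∧
      ∀ᶠ z in 𝓝 (a, b), ∀ (i : Fin m) (k : ℕ), lineDeriv ℂ h z (unitU i k, 0) = 0 := by
  let l : Jet m →L[ℂ] ℂ := ContinuousLinearMap.fst ℂ _ _
  obtain ⟨h, hh, hid, hd⟩ := hA.exists_flow l (finAnalyticAt_fst_x _) (1, 0, 0) 0 1 0
  have hgerm : IsGaugeGerm a b h :=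
    .of_eq_snd hh (P := fun y => l (y - a) = 0) (by simp) hid
  have hzero : ∀ᶠ z in 𝓝 (a, b), ∀ (i : Fin m) (k : ℕ), lineDeriv ℂ h z (unitU i k, 0) = 0 := by
    filter_upwards [hd] with z hz i k
    rw [hz _ (by simp [mask_apply, unitU, Prod.ext_iff, funext_iff])]
    simp [l, unitU]
  refine ⟨h, hgerm, hgerm.vanishFrom_of_lineDeriv_eq_zero hA hV hzero, ?_, hzero⟩
  filter_upwards [hd] with z hz hu
  rw [gaugeField, hz _ (by simp [mask_apply, fieldX, Prod.ext_iff, funext_iff])]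
  -- Because h is independent of u, D_x h = ∂h/∂x, and along u = a this equals A at the image point,
  -- by the choice of equation.
  have h2 : a + l (z.1 - a) • (1, 0, 0) + mask 0 1 0 (z.1 - a) = z.1 := by
    simp [l, mask_apply, Prod.ext_iff, funext_iff, ← hu]
  rw [h2]
  simp [l, fieldX, gaugeMap]

/-- Normalization of `B` along `x = x₀`, `u = a`. -/
theorem exists_gauge_t {d : ℕ} (S : EvolutionSystem m d) (hA : FinAnalyticAt A (a, b))
    (hB : FinAnalyticAt B (a, b)) (hV : VanishFrom a b A 0)
    (hA0 : ∀ᶠ z in 𝓝 (a, b), z.1.2.2 = a.2.2 → A z = 0) :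
    ∃ h, IsGaugeGerm a b h ∧ VanishFrom a b (gaugeField fieldX h A) 0 ∧
      (∀ᶠ z in 𝓝 (a, b), z.1.2.2 = a.2.2 → gaugeField fieldX h A z = 0) ∧
      (∀ᶠ z in 𝓝 (a, b), z.1.1 = a.1 → z.1.2.2 = a.2.2 → gaugeField S.fieldT h B z = 0) ∧
      ∀ᶠ z in 𝓝 (a, b), ∀ (i : Fin m) (k : ℕ), lineDeriv ℂ h z (unitU i k, 0) = 0 := by
  let l : Jet m →L[ℂ] ℂ :=
    (ContinuousLinearMap.fst ℂ ℂ (Fin m → ℕ → ℂ)).comp (ContinuousLinearMap.snd ℂ _ _)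
  obtain ⟨h, hh, hid, hd⟩ := hB.exists_flow l (finAnalyticAt_fst_t _) (0, 1, 0) 0 0 0
  have hmask : ∀ y : Jet m, mask 0 0 0 y = 0 := fun y => by
    simp [mask_apply, Prod.ext_iff, funext_iff]
  have hgerm : IsGaugeGerm a b h :=
    .of_eq_snd hh (P := fun y => l (y - a) = 0) (by simp) hid
  have hzero : ∀ᶠ z in 𝓝 (a, b), ∀ (i : Fin m) (k : ℕ), lineDeriv ℂ h z (unitU i k, 0) = 0 := by
    filter_upwards [hd] with z hz i k
    rw [hz _ (hmask _)]
    simp [l, unitU]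
  refine ⟨h, hgerm, hgerm.vanishFrom_of_lineDeriv_eq_zero hA hV hzero, ?_, ?_, hzero⟩
  -- Here h depends only on t and w, so D_x h = 0 and the vanishing of A along u = a is preserved.
  · filter_upwards [hd, hgerm.tendsto.eventually hA0] with z hz hz0 hu
    rw [gaugeField, hz _ (hmask _), hz0 hu]
    simp [l, fieldX]
  · filter_upwards [hd] with z hz hx hu
    rw [gaugeField, hz _ (hmask _)]
    have h2 : a + l (z.1 - a) • (0, 1, 0) + mask 0 0 0 (z.1 - a) = z.1 := by
      rw [hmask]
      simp [l, Prod.ext_iff, ← hu, ← hx]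
    rw [h2]
    simp [l, EvolutionSystem.fieldT, gaugeMap]

end Existence

/-! ### Normalizing germs: existence and uniqueness -/

section Normalization

variable {m d q : ℕ} {a : Jet m} {b : Fin q → ℂ} (S : EvolutionSystem m d)

/-- The normalization conditions for a pair of germs. -/
structure IsNormalGerm (a : Jet m) (b : Fin q → ℂ) (A B : Tot m q → Fin q → ℂ) : Prop where
  deriv_A : VanishFrom a b A 0
  val_A : ∀ᶠ z in 𝓝 (a, b), z.1.2.2 = a.2.2 → A z = 0
  val_B : ∀ᶠ z in 𝓝 (a, b), z.1.1 = a.1 → z.1.2.2 = a.2.2 → B z = 0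

theorem IsNormalGerm.congr {A A' B B' : Tot m q → Fin q → ℂ} (h : IsNormalGerm a b A B)
    (hA : A =ᶠ[𝓝 (a, b)] A') (hB : B =ᶠ[𝓝 (a, b)] B') : IsNormalGerm a b A' B' := by
  refine ⟨h.deriv_A.congr hA, ?_, ?_⟩
  · filter_upwards [h.val_A, hA] with z h1 h2
    rwa [← h2]
  · filter_upwards [h.val_B, hB] with z h1 h2
    rwa [← h2]

/-- Existence of a normalizing gauge transformation, as a germ. -/
theorem exists_normalizing_germ {A B : Tot m q → Fin q → ℂ} (ha : a ∈ S.prolongation)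
    (hA : FinAnalyticAt A (a, b)) (hB : FinAnalyticAt B (a, b)) {p : ℕ}
    (hp : ∀ᶠ z in 𝓝 (a, b), ∀ (i : Fin m) (k : ℕ), p < k → lineDeriv ℂ A z (unitU i k, 0) = 0) :
    ∃ g, IsGaugeGerm a b g ∧
      IsNormalGerm a b (gaugeField fieldX g A) (gaugeField S.fieldT g B) ∧
      ∀ᶠ z in 𝓝 (a, b), ∀ (i : Fin m) (k : ℕ), p ≤ k → lineDeriv ℂ g z (unitU i k, 0) = 0 := by
  have hX := finAnalyticFieldAt_X (a, b)
  have hT := finAnalyticFieldAt_T (q := q) S (z := (a, b)) ha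
  obtain ⟨g₁, hg₁, hV₁, hp₁⟩ := exists_gauge_vanishFrom hA hp
  have hA₁ := hg₁.finAnalyticAt_gaugeField hA hX
  have hB₁ := hg₁.finAnalyticAt_gaugeField hB hT
  obtain ⟨g₂, hg₂, hV₂, h0₂, hd₂⟩ := exists_gauge_x hA₁ hV₁
  have hA₂ := hg₂.finAnalyticAt_gaugeField hA₁ hX
  have hB₂ := hg₂.finAnalyticAt_gaugeField hB₁ hT
  obtain ⟨g₃, hg₃, hV₃, h0₃, hB0₃, hd₃⟩ := exists_gauge_t S hA₂ hB₂ hV₂ h0₂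
  have key : ∀ (c : Jet m → Jet m) (C : Tot m q → Fin q → ℂ),
      gaugeField c g₃ (gaugeField c g₂ (gaugeField c g₁ C)) =ᶠ[𝓝 (a, b)]
        gaugeField c (fun z => g₁ (gaugeMap (fun z => g₂ (gaugeMap g₃ z)) z)) C := by
    intro c C
    exact ((hg₁.gaugeField_comp (hg₂.comp hg₃)).trans (hg₂.gaugeField_comp hg₃)).symm
  refine ⟨_, hg₁.comp (hg₂.comp hg₃),
    IsNormalGerm.congr ⟨hV₃, h0₃, hB0₃⟩ (key _ _) (key _ _), ?_⟩
  have h23 := hg₂.comp hg₃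
  filter_upwards [h23.tendsto.eventually hp₁, hg₃.tendsto.eventually hd₂, hd₃,
    hg₃.analytic.eventually, hg₃.tendsto.eventually hg₂.analytic.eventually,
    h23.analytic.eventually, h23.tendsto.eventually hg₁.analytic.eventually]
    with z h1 h2 h3 h4 h5 h6 h7 i k hk
  rw [h7.lineDeriv_map_comp (finAnalyticMapAt_gaugeMap h6), mapDeriv_gaugeMap,
    h5.lineDeriv_map_comp (finAnalyticMapAt_gaugeMap h4), mapDeriv_gaugeMap, h3 i k, h2 i k]
  exact h1 i k hk

/-- Second derivatives in constant directions commute, so they vanish when one of the first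
derivatives does. -/
theorem FinAnalyticAt.lineDeriv_lineDeriv_eq_zero {f : Tot m q → Fin q → ℂ} {z : Tot m q}
    (hf : FinAnalyticAt f z) (e e' : Jet m)
    (h : ∀ᶠ z' in 𝓝 z, lineDeriv ℂ f z' (e', 0) = 0) :
    lineDeriv ℂ (fun z => lineDeriv ℂ f z (e, 0)) z (e', 0) = 0 := by
  have hcomm := hf.lineDeriv_commutator (finAnalyticFieldAt_const e' z)
    (finAnalyticFieldAt_const e z)
  rw [mapDeriv_const, mapDeriv_const, lineDeriv_congr (g := fun _ => 0) h, lineDeriv_const',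
    sub_zero, sub_zero] at hcomm
  rw [hcomm]
  simp [lineDeriv]

/-- A function that is independent of some of the coordinates vanishes if it does so where these
coordinates have their values at `a`. -/
theorem FinAnalyticAt.eventually_eq_zero {f : Tot m q → Fin q → ℂ} (hf : FinAnalyticAt f (a, b))
    {cx ct : ℂ} {χ : Fin m → ℕ → ℂ} (hcx : cx * cx = cx) (hct : ct * ct = ct)
    (hχ : ∀ i k, χ i k * χ i k = χ i k)
    (h0 : ∀ᶠ z in 𝓝 (a, b), ∀ η, lineDeriv ℂ f z (mask cx ct χ η, 0) = 0)
    (h1 : ∀ᶠ z in 𝓝 (a, b), mask cx ct χ (z.1 - a) = 0 → f z = 0) :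
    ∀ᶠ z in 𝓝 (a, b), f z = 0 := by
  have hc : Tendsto (fun z : Tot m q => ((z.1 - mask cx ct χ (z.1 - a), z.2) : Tot m q))
      (𝓝 (a, b)) (𝓝 (a, b)) := by
    have h := (mask cx ct χ).continuous
    have h2 : Continuous fun z : Tot m q =>
        ((z.1 - mask cx ct χ (z.1 - a), z.2) : Tot m q) := by fun_prop
    simpa using h2.tendsto (a, b)
  filter_upwards [hf.eventually_eq_of_lineDeriv_eq_zero _ h0, hc.eventually h1] with z hz hz1
  rw [hz]
  refine hz1 ?_
  have hidem : ∀ y, mask cx ct χ (mask cx ct χ y) = mask cx ct χ y := fun y => by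
    simp only [mask_apply, ← mul_assoc, hcx, hct, hχ]
  simp only [map_sub, hidem]
  abel

/-- A gauge transformation between normalized coverings that is the identity over `a` is the
identity near `(a, b)`. -/
theorem IsGaugeGerm.eventually_eq_snd {h A B : Tot m q → Fin q → ℂ} (hh : IsGaugeGerm a b h)
    (hA : FinAnalyticAt A (a, b)) (hAB : IsNormalGerm a b A B)
    (hAB' : IsNormalGerm a b (gaugeField fieldX h A) (gaugeField S.fieldT h B)) :
    ∀ᶠ z in 𝓝 (a, b), h z = z.2 := by
  classical
  have hder : ∀ e : Jet m, FinAnalyticAt (fun z => lineDeriv ℂ h z (e, 0)) (a, b) := fun e =>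
    hh.analytic.lineDeriv_field (finAnalyticFieldAt_const e (a, b))
  -- independence of `u`, by descending induction
  have hu : ∀ᶠ z in 𝓝 (a, b), ∀ (i : Fin m) (k : ℕ), lineDeriv ℂ h z (unitU i k, 0) = 0 := by
    obtain ⟨n, φ, hφ, hhφ⟩ := hh.analytic
    suffices H : ∀ j r, r + j = (n + 1) * m → ∀ᶠ z in 𝓝 (a, b), ∀ (i : Fin m) (k : ℕ),
        r ≤ rank i k → lineDeriv ℂ h z (unitU i k, 0) = 0 from
      (H _ 0 (zero_add _)).mono fun z hz i k => hz i k (Nat.zero_le _)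
    intro j
    induction j with
    | zero =>
      intro r hr
      filter_upwards [FinAnalyticAt.lineDeriv_eventually_eq hφ hhφ] with z hz i k hik
      -- The descent starts beyond the order n of the germ h itself.
      have hk : n < k := le_of_mul_le_rank (p := n + 1) (by rw [← hr]; simpa using hik)
      rw [hz, proj_unitU_eq_zero hk, map_zero]
    | succ j ih =>
      intro r hr
      have hr1 := ih (r + 1) (by omega)
      obtain ⟨i₀, k₀, rfl, -⟩ := exists_rank_eq (show r < (n + 1) * m by omega)
      let χ : Fin m → ℕ → ℂ := fun i k => if Prec i₀ k₀ i k then 1 else 0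
      have hf := hder (unitU i₀ k₀)
      -- By equality of mixed derivatives ∂h/∂u^{i₀}_{k₀} is independent of the later coordinates,
      -- so it may be tested where these equal their values at a. There the key identity and the
      -- normalization of both coverings make it vanish.
      have h0 : ∀ᶠ z in 𝓝 (a, b), lineDeriv ℂ h z (unitU i₀ k₀, 0) = 0 := by
        refine hf.eventually_eq_zero (cx := 0) (ct := 0) (χ := χ) (by simp) (by simp)
          (fun i k => by simp only [χ]; split_ifs <;> simp) ?_ ?_
        · filter_upwards [hr1.eventually_nhds, hf.eventually, hh.analytic.eventually]
            with z hz1 hz2 hz3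
          refine hz2.lineDeriv_mask_eq_zero (by simp) (by simp) fun i k hik => ?_
          refine hz3.lineDeriv_lineDeriv_eq_zero _ _ (hz1.mono fun z' hz' => hz' i k ?_)
          have : Prec i₀ k₀ i k := by
            by_contra hc
            simp [χ, hc] at hik
          exact prec_iff_rank_lt.1 this
        · filter_upwards [hr1.eventually_nhds, hh.regularAt.eventually,
            hh.tendsto.eventually hA.eventually, hh.tendsto.eventually hAB.deriv_A,
            hAB'.deriv_A] with z hz1 hz2 hz3 hz4 hz5 hloc
          have hloc' : ∀ i' k', Prec i₀ k₀ i' k' → z.1.2.2 i' k' = a.2.2 i' k' := by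
            intro i' k' hp
            have := congrArg (fun y : Jet m => y.2.2 i' k') hloc
            simpa [mask_apply, χ, hp, sub_eq_zero] using this
          have key := hz2.lineDeriv_gaugeField_unitU hz3
            (hz1.mono fun z' hz' => hz' i₀ (k₀ + 1) (rank_lt_rank_succ i₀ k₀))
          rw [hz5 i₀ k₀ (Nat.zero_le _) hloc', map_zero, add_zero,
            hz4 i₀ k₀ (Nat.zero_le _) hloc'] at key
          exact key
      filter_upwards [h0, hr1] with z hz0 hz1 i k hik
      rcases hik.eq_or_lt with heq | hlt
      · obtain ⟨rfl, rfl⟩ := rank_inj heq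
        exact hz0
      · exact hz1 i k hlt
  have huu : ∀ e : Jet m, ∀ᶠ z in 𝓝 (a, b), ∀ (i : Fin m) (k : ℕ),
      lineDeriv ℂ (fun z => lineDeriv ℂ h z (e, 0)) z (unitU i k, 0) = 0 := by
    intro e
    filter_upwards [hu.eventually_nhds, hh.analytic.eventually] with z hz1 hz2 i k
    exact hz2.lineDeriv_lineDeriv_eq_zero _ _ (hz1.mono fun z' hz' => hz' i k)
  -- independence of `x`
  have hx : ∀ᶠ z in 𝓝 (a, b), lineDeriv ℂ h z ((1, 0, 0), 0) = 0 := by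
    have hf := hder (1, 0, 0)
    refine hf.eventually_eq_zero (cx := 0) (ct := 0) (χ := 1) (by simp) (by simp)
      (by simp) ?_ ?_
    · filter_upwards [huu (1, 0, 0), hf.eventually] with z hz1 hz2
      exact hz2.lineDeriv_mask_eq_zero (by simp) (by simp) fun i k _ => hz1 i k
    · filter_upwards [hu, hh.regularAt.eventually, hh.tendsto.eventually hAB.val_A, hAB'.val_A]
        with z hz1 hz2 hz3 hz4 hloc
      have hloc' : z.1.2.2 = a.2.2 := by
        have := congrArg (fun y : Jet m => y.2.2) hloc
        simpa [mask_apply, sub_eq_zero, funext_iff] using this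
      -- Along u = a both A and its transform vanish, so D_x h = 0; as h is independent of u, this
      -- says ∂h/∂x = 0.
      have key := hz2.lineDeriv_gaugeField (c := fieldX) (A := A)
      rw [hz4 hloc', hz3 hloc', hz2.analytic.lineDeriv_horizontal] at key
      simpa [fieldX, hz1] using key
  -- independence of `t`
  have ht : ∀ᶠ z in 𝓝 (a, b), lineDeriv ℂ h z ((0, 1, 0), 0) = 0 := by
    have hf := hder (0, 1, 0)
    refine hf.eventually_eq_zero (cx := 1) (ct := 0) (χ := 1) (by simp) (by simp)
      (by simp) ?_ ?_
    · filter_upwards [huu (0, 1, 0), hf.eventually, hx.eventually_nhds,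
        hh.analytic.eventually] with z hz1 hz2 hz3 hz4
      exact hz2.lineDeriv_mask_eq_zero (fun _ => hz4.lineDeriv_lineDeriv_eq_zero _ _ hz3)
        (by simp) fun i k _ => hz1 i k
    · filter_upwards [hu, hx, hh.regularAt.eventually, hh.tendsto.eventually hAB.val_B, hAB'.val_B]
        with z hz1 hzx hz2 hz3 hz4 hloc
      have hloc' : z.1.2.2 = a.2.2 := by
        have := congrArg (fun y : Jet m => y.2.2) hloc
        simpa [mask_apply, sub_eq_zero, funext_iff] using this
      have hlocx : z.1.1 = a.1 := by
        have := congrArg (fun y : Jet m => y.1) hloc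
        simpa [mask_apply, sub_eq_zero] using this
      have key := hz2.lineDeriv_gaugeField (c := S.fieldT) (A := B)
      rw [hz4 hlocx hloc', hz3 hlocx hloc', hz2.analytic.lineDeriv_horizontal] at key
      simpa [EvolutionSystem.fieldT, hz1] using key
  have hall : ∀ᶠ z in 𝓝 (a, b), ∀ η, lineDeriv ℂ h z (mask 1 1 1 η, 0) = 0 := by
    filter_upwards [hu, hx, ht, hh.analytic.eventually] with z h1 h2 h3 h4
    exact h4.lineDeriv_mask_eq_zero (fun _ => h2) (fun _ => h3) fun i k _ => h1 i k
  have hw : ∀ᶠ z : Tot m q in 𝓝 (a, b), h (a, z.2) = z.2 :=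
    (continuous_snd.tendsto (a, b)).eventually hh.identity
  filter_upwards [hh.analytic.eventually_eq_of_lineDeriv_eq_zero _ hall, hw] with z h1 h2
  rw [h1]
  have : mask 1 1 1 (z.1 - a) = z.1 - a := by simp [mask_apply, Prod.ext_iff, funext_iff]
  rw [this, sub_sub_cancel, h2]

theorem gaugeField_congr_left {g g' A : Tot m q → Fin q → ℂ} {c : Jet m → Jet m} {z : Tot m q}
    (h : g =ᶠ[𝓝 z] g') : gaugeField c g A =ᶠ[𝓝 z] gaugeField c g' A := by
  filter_upwards [h.eventually_nhds] with z' hz'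
  have hj : jac g z' = jac g' z' := by
    have hc : ContinuousAt (fun w => (z'.1, w)) z'.2 := by fun_prop
    exact Filter.EventuallyEq.fderiv_eq (hc.eventually hz')
  simp only [gaugeField, hj, lineDeriv_congr hz', gaugeMap]
  rw [hz'.self_of_nhds]

/-- Uniqueness of the normalizing gauge transformation, as a germ. -/
theorem IsGaugeGerm.eventuallyEq {g g' A B : Tot m q → Fin q → ℂ} (hg : IsGaugeGerm a b g)
    (hg' : IsGaugeGerm a b g') (hA : FinAnalyticAt A (a, b))
    (hn : IsNormalGerm a b (gaugeField fieldX g A) (gaugeField S.fieldT g B))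
    (hn' : IsNormalGerm a b (gaugeField fieldX g' A) (gaugeField S.fieldT g' B)) :
    g' =ᶠ[𝓝 (a, b)] g := by
  obtain ⟨h, hh, -, hl, hr⟩ := hg.regularAt.exists_inverse hg.apply_self
  have hgerm : IsGaugeGerm a b h := by
    refine ⟨hh, ?_⟩
    have hc : Tendsto (fun w => (a, w)) (𝓝 b) (𝓝 (a, b)) :=
      Continuous.tendsto (by fun_prop : Continuous fun w => (a, w)) b
    filter_upwards [hc.eventually hl, hg.identity] with w h1 h2
    simpa only [gaugeMap, h2] using h1
  -- The comparison map g⁻¹∘g' transforms the covering normalized by g into the one normalized by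
  -- g'.
  have hk := hgerm.comp hg'
  have heq : g' =ᶠ[𝓝 (a, b)] fun z => g (gaugeMap (fun z => h (gaugeMap g' z)) z) := by
    filter_upwards [hg'.tendsto.eventually hr] with z hz
    exact hz.symm
  have hfield : ∀ (c : Jet m → Jet m) (C : Tot m q → Fin q → ℂ), gaugeField c g' C =ᶠ[𝓝 (a, b)]
      gaugeField c (fun z => h (gaugeMap g' z)) (gaugeField c g C) := fun c C =>
    (gaugeField_congr_left heq).trans (hg.gaugeField_comp hk)
  have hfin := hk.eventually_eq_snd S
    (hg.finAnalyticAt_gaugeField hA (finAnalyticFieldAt_X (a, b))) hn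
    (hn'.congr (hfield _ _) (hfield _ _))
  filter_upwards [heq, hfin] with z h1 h2
  rw [h1]
  simp only [gaugeMap] at h2 ⊢
  rw [h2]

end Normalization

/-! ### From germs to neighborhoods -/

section Assembly

variable {m d q : ℕ} {a : Jet m} {b : Fin q → ℂ} {S : EvolutionSystem m d}

theorem IsNormalizingGauge.germ {Ω N : Set (Tot m q)} {A B g : Tot m q → Fin q → ℂ}
    (h : IsNormalizingGauge S Ω A B a b N g) :
    IsGaugeGerm a b g ∧ IsNormalGerm a b (gaugeField fieldX g A) (gaugeField S.fieldT g B) := by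
  have hN : N ∈ 𝓝 (a, b) := h.gauge.isOpen.mem_nhds h.mem
  have hFA : ∀ z ∈ N, FinAnalyticAt g z := fun z hz =>
    h.gauge.analytic.finAnalyticAt h.gauge.isOpen hz
  have hAe : gaugeA g A =ᶠ[𝓝 (a, b)] gaugeField fieldX g A := by
    filter_upwards [hN] with z hz using gaugeA_eq_gaugeField (hFA z hz) A
  have hBe : gaugeB S g B =ᶠ[𝓝 (a, b)] gaugeField S.fieldT g B := by
    filter_upwards [hN] with z hz using gaugeB_eq_gaugeField S (hFA z hz) B
  refine ⟨.of_eq_snd (hFA _ h.mem) (P := fun y => y = a) rfl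
    (mem_of_superset hN h.identity_at), IsNormalGerm.congr ⟨?_, ?_, ?_⟩ hAe hBe⟩
  · filter_upwards [hN] with z hz i k _ hloc
    rw [← pdu_eq_lineDeriv]
    exact h.normalized.deriv_A i k z hz hloc
  · exact mem_of_superset hN h.normalized.val_A
  · exact mem_of_superset hN h.normalized.val_B

/-- With h the local inverse, the image of N is the part of V that h maps into N, hence open.
Allowing every open N inside U leaves room for shrinking. -/
theorem IsGaugeGerm.exists_isGauge {g : Tot m q → Fin q → ℂ} (hg : IsGaugeGerm a b g) :
    ∃ U ∈ 𝓝 (a, b), ∀ N ⊆ U, IsOpen N → IsGauge N g := by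
  obtain ⟨h, hh, hhab, hl, hr⟩ := hg.regularAt.exists_inverse hg.apply_self
  obtain ⟨U₁, hU₁, hgU⟩ := hg.analytic.exists_mem_nhds
  obtain ⟨U₂, hU₂, hhU⟩ := hh.exists_mem_nhds
  obtain ⟨V, hVsub, hVo, hVab⟩ := mem_nhds_iff.1 (inter_mem hU₂ (hr.and hh.eventually))
  refine ⟨_, inter_mem hU₁ (hl.and (hg.tendsto.eventually (hVo.mem_nhds hVab))), ?_⟩
  intro N hN hNo
  have himage : gaugeMap g '' N = V ∩ gaugeMap h ⁻¹' N := by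
    ext z'
    constructor
    · rintro ⟨z, hz, rfl⟩
      refine ⟨(hN hz).2.2, ?_⟩
      have : gaugeMap h (gaugeMap g z) = z := Prod.ext rfl (hN hz).2.1
      rwa [Set.mem_preimage, this]
    · rintro ⟨h1, h2⟩
      exact ⟨gaugeMap h z', h2, Prod.ext rfl (hVsub h1).2.1⟩
  have hopen : IsOpen (gaugeMap g '' N) := by
    rw [himage]
    have hc : ContinuousOn (gaugeMap h) V := fun z hz =>
      (finAnalyticMapAt_gaugeMap (hVsub hz).2.2).continuousAt.continuousWithinAt
    exact hc.isOpen_inter_preimage hVo hNo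
  refine ⟨hNo, hgU.mono fun z hz => (hN hz).1, hopen, h, hhU.mono fun z hz => ?_,
    fun z hz => (hN hz).2.1⟩
  rw [himage] at hz
  exact (hVsub hz.1).1

end Assembly

end
end EvoCov

/-! ### The theorem -/

open EvoCov in
theorem mainTheorem2 {m d q : ℕ} (S : EvoCov.EvolutionSystem m d) (p : ℕ)
    (Ω : Set (EvoCov.Tot m q)) (A B : EvoCov.Tot m q → (Fin q → ℂ))
    (hcov : S.IsCovering Ω A B) (hord : EvoCov.OrderLE p Ω A)
    (a : EvoCov.Jet m) (b : Fin q → ℂ) (hab : (a, b) ∈ Ω) :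
    ∃ (N : Set (EvoCov.Tot m q)) (g : EvoCov.Tot m q → (Fin q → ℂ)),
      EvoCov.IsNormalizingGauge S Ω A B a b N g ∧
      -- uniqueness, on `N` and as a germ at `(a, b)`
      (∀ g' : EvoCov.Tot m q → (Fin q → ℂ),
        EvoCov.IsNormalizingGauge S Ω A B a b N g' → Set.EqOn g' g N) ∧
      (∀ (N' : Set (EvoCov.Tot m q)) (g' : EvoCov.Tot m q → (Fin q → ℂ)),
        EvoCov.IsNormalizingGauge S Ω A B a b N' g' → g' =ᶠ[𝓝 (a, b)] g) ∧
      -- `∂g/∂u^i_k = 0` for `k ≥ p`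
      (∀ z ∈ N, ∀ (i : Fin m) (k : ℕ), p ≤ k → EvoCov.pdu i k (fun y => g (y, z.2)) z.1 = 0) ∧
      -- the transformed covering has order `≤ p`
      S.IsCovering N (EvoCov.gaugeA g A) (EvoCov.gaugeB S g B) ∧
      EvoCov.OrderLE p N (EvoCov.gaugeA g A) := by
  have hΩ : Ω ∈ 𝓝 (a, b) := hcov.isOpen.mem_nhds hab
  have hAΩ : ∀ z ∈ Ω, FinAnalyticAt A z := fun z hz => hcov.analytic_A.finAnalyticAt hcov.isOpen hz
  have hBΩ : ∀ z ∈ Ω, FinAnalyticAt B z := fun z hz => hcov.analytic_B.finAnalyticAt hcov.isOpen hz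
  have hordΩ : ∀ z ∈ Ω, ∀ (i : Fin m) (k : ℕ), p < k → lineDeriv ℂ A z (unitU i k, 0) = 0 := by
    intro z hz i k hk
    rw [← pdu_eq_lineDeriv]
    exact hord z hz i k hk
  obtain ⟨g, hg, hn, hgp⟩ := exists_normalizing_germ S (hcov.subset _ hab) (hAΩ _ hab) (hBΩ _ hab)
    (mem_of_superset hΩ hordΩ)
  obtain ⟨U, hU, hUg⟩ := hg.exists_isGauge
  -- `FinAnalyticOn` demands a single truncation order and a single representative on all of N, so
  -- both must be fixed before N is chosen.
  obtain ⟨U₁, hU₁, hA₁⟩ := (hg.finAnalyticAt_gaugeField (hAΩ _ hab)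
    (finAnalyticFieldAt_X (a, b))).exists_mem_nhds
  obtain ⟨U₂, hU₂, hB₂⟩ := (hg.finAnalyticAt_gaugeField (hBΩ _ hab)
    (finAnalyticFieldAt_T S (hcov.subset _ hab))).exists_mem_nhds
  have hid : ∀ᶠ z : Tot m q in 𝓝 (a, b), g (a, z.2) = z.2 :=
    (continuous_snd.tendsto (a, b)).eventually hg.identity
  -- Convexity of N is what turns uniqueness of germs into uniqueness on N.
  obtain ⟨N, hNU, hNo, hNc, hNab⟩ := exists_convex_open_subset (inter_mem hU (inter_mem hU₁
    (inter_mem hU₂ ((hg.regularAt.eventually.and (hg.tendsto.eventually hΩ)).and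
      ((hn.deriv_A.and (hn.val_A.and hn.val_B)).and (hgp.and hid))))))
  have hgauge : IsGauge N g := hUg N (fun z hz => (hNU hz).1) hNo
  have hreg : ∀ z ∈ N, RegularAt g z := fun z hz => (hNU hz).2.2.2.1.1
  have hmaps : ∀ z ∈ N, gaugeMap g z ∈ Ω := fun z hz => (hNU hz).2.2.2.1.2
  have hder : ∀ z ∈ N, ∀ (i : Fin m) (k : ℕ), p ≤ k → lineDeriv ℂ g z (unitU i k, 0) = 0 :=
    fun z hz => (hNU hz).2.2.2.2.2.1
  have hAeq : ∀ z ∈ N, gaugeA g A z = gaugeField fieldX g A z := fun z hz =>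
    gaugeA_eq_gaugeField (hreg z hz).analytic A
  have hBeq : ∀ z ∈ N, gaugeB S g B z = gaugeField S.fieldT g B z := fun z hz =>
    gaugeB_eq_gaugeField S (hreg z hz).analytic B
  have hAev : ∀ z ∈ N, gaugeA g A =ᶠ[𝓝 z] gaugeField fieldX g A := fun z hz =>
    mem_of_superset (hNo.mem_nhds hz) hAeq
  have hBev : ∀ z ∈ N, gaugeB S g B =ᶠ[𝓝 z] gaugeField S.fieldT g B := fun z hz =>
    mem_of_superset (hNo.mem_nhds hz) hBeq
  have hpdu : ∀ z ∈ N, ∀ (i : Fin m) (k : ℕ), pdu i k (fun y => gaugeA g A (y, z.2)) z.1 =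
      lineDeriv ℂ (gaugeField fieldX g A) z (unitU i k, 0) := fun z hz i k => by
    rw [pdu_eq_lineDeriv, lineDeriv_congr (hAev z hz)]
  have hnorm : IsNormalizingGauge S Ω A B a b N g := by
    refine ⟨hNab, hgauge, hmaps, ⟨fun i k z hz hloc => ?_, fun z hz hu => ?_,
      fun z hz hx hu => ?_⟩, ?_⟩
    · rw [hpdu z hz]
      exact (hNU hz).2.2.2.2.1.1 i k (Nat.zero_le _) hloc
    · rw [hAeq z hz]
      exact (hNU hz).2.2.2.2.1.2.1 hu
    · rw [hBeq z hz]
      exact (hNU hz).2.2.2.2.1.2.2 hx hu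
    · rintro ⟨y, w⟩ hz rfl
      exact (hNU hz).2.2.2.2.2.2
  have huniq : ∀ (N' : Set (Tot m q)) (g' : Tot m q → (Fin q → ℂ)),
      IsNormalizingGauge S Ω A B a b N' g' → g' =ᶠ[𝓝 (a, b)] g := fun N' g' h' =>
    hg.eventuallyEq S h'.germ.1 (hAΩ _ hab) hn h'.germ.2
  refine ⟨N, g, hnorm, fun g' h' => ?_, huniq, fun z hz i k hk => ?_, ?_, fun z hz i k hk => ?_⟩
  · exact eqOn_of_convex hNc hNab
      (fun z hz => h'.gauge.analytic.finAnalyticAt hNo hz)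
      (fun z hz => (hreg z hz).analytic) (huniq N g' h')
  · rw [pdu_eq_lineDeriv]
    exact hder z hz i k hk
  · have hAN : FinAnalyticOn (gaugeA g A) N := by
      obtain ⟨n, φ, hφ⟩ := hA₁
      exact ⟨n, φ, fun z hz => ⟨(hφ z (hNU hz).2.1).1, (hAeq z hz).trans (hφ z (hNU hz).2.1).2⟩⟩
    have hBN : FinAnalyticOn (gaugeB S g B) N := by
      obtain ⟨n, φ, hφ⟩ := hB₂
      exact ⟨n, φ, fun z hz =>
        ⟨(hφ z (hNU hz).2.2.1).1, (hBeq z hz).trans (hφ z (hNU hz).2.2.1).2⟩⟩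
    refine ⟨hNo, fun z hz => hcov.subset (gaugeMap g z) (hmaps z hz), hAN, hBN, fun z hz => ?_⟩
    rw [zeroCurvature_eq S (hAN.finAnalyticAt hNo hz) (hBN.finAnalyticAt hNo hz),
      lineDeriv_congr (hAev z hz), lineDeriv_congr (hBev z hz), hAeq z hz, hBeq z hz, sub_eq_zero]
    refine (hreg z hz).zeroCurvature S (hAΩ _ (hmaps z hz)) (hBΩ _ (hmaps z hz))
      (hcov.subset (gaugeMap g z) (hmaps z hz)) ?_
    have := hcov.compat _ (hmaps z hz)
    rw [zeroCurvature_eq S (hAΩ _ (hmaps z hz)) (hBΩ _ (hmaps z hz)), sub_eq_zero] at this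
    exact this
  · rw [hpdu z hz]
    -- With the index written as k+1 > p one has k ≥ p, so g depends on neither u^i_k nor u^i_{k+1}.
    -- The key identity then carries the order bound over from A.
    obtain ⟨k, rfl⟩ : ∃ k', k = k' + 1 := ⟨k - 1, by omega⟩
    have key := (hreg z hz).lineDeriv_gaugeField_unitU (hAΩ _ (hmaps z hz)) (i := i) (k := k)
      (mem_of_superset (hNo.mem_nhds hz) fun z' hz' => hder z' hz' i (k + 1) hk.le)
    rw [hder z hz i k (by omega), zero_add, hordΩ _ (hmaps z hz) i (k + 1) hk] at key
    exact (hreg z hz).jac_eq_zero key
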